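/- Let $n\ge 1$. For $f\in L^p(\mathbb{R}^n)$ let $\mathcal{F}f(\xi)=(2\pi)^{-n/2}\int_{\mathbb{R}^n} f(x)e^{-ix\cdot\xi}\,dx$ denote the Fourier transform, understood in the sense of tempered distributions. Fix a window $\rho\in C_0^\infty(\mathbb{R}^n)$ with values in $[0,1]$, with support in $\{\xi: |\xi_i|\le 1,\ i=1,\dots,n\}$ and with $\rho(\xi)=1$ whenever $|\xi_i|\le \frac12$ for all $i$. For $k\in\mathbb{Z}^n$ put \[ \sigma_k(\xi)=\rho(\xi-k)\Big(\sum_{l\in\mathbb{Z}^n}\rho(\xi-l)\Big)^{-1},\qquad \Box_k f=\mathcal{F}^{-1}(\sigma_k\,\mathcal{F}f). \] For $s>0$ and $1\le p,q\le\infty$ the Gevrey-modulation space $\mathcal{GM}^s_{p,q}(\mathbb{R}^n)$ is the set of all $f\in L^p(\mathbb{R}^n)$ with \[ \|f\|_{\mathcal{GM}^s_{p,q}}=\Big(\sum_{k\in\mathbb{Z}^n} e^{q|k|^{1/s}}\,\|\Box_k f\|_{L^p}^q\Big)^{1/q}<\infty \] (for $q=\infty$: $\sup_k e^{|k|^{1/s}}\|\Box_k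 f\|_{L^p}$), where $|k|$ is the Euclidean norm. **Lemma.** Let $s>1$, $1<p<\infty$ and $1\le q\le\infty$. There are constants $b,c>0$ (which may depend on $n,s,p,q$ and $\rho$) such that for every real-valued $u\in\mathcal{GM}^s_{p,q}(\mathbb{R}^n)$ the function $e^{iu}-1$ belongs to $\mathcal{GM}^s_{p,q}(\mathbb{R}^n)$ and \[ \|e^{iu}-1\|_{\mathcal{GM}^s_{p,q}}\le c\,\|u\|_{\mathcal{GM}^s_{p,q}}\cdot \begin{cases} \exp\!\big(b\,\|u\|_{\mathcal{GM}^s_{p,q}}^{1/s}\,\log\|u\|_{\mathcal{GM}^s_{p,q}}\big) & \text{if } \|u\|_{\mathcal{GM}^s_{p,q}}>1,\\ 1 & \text{if } \|u\|_{\mathcal{GM}^s_{p,q}}\le 1. \end{cases} \] -/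

import Mathlib

open MeasureTheory
open scoped ENNReal SchwartzMap

noncomputable section

namespace GevreyModulation

/-- The lattice point `k ∈ ℤⁿ`, as an element of `ℝⁿ` with its Euclidean norm. -/
def latticePoint {n : ℕ} (k : Fin n → ℤ) : EuclideanSpace ℝ (Fin n) :=
  WithLp.toLp 2 (fun i => (k i : ℝ))

/-- Admissible windows: smooth functions `ρ : ℝⁿ → [0,1]` supported in the cube
`Q₀ = {ξ : |ξ_i| ≤ 1 for all i}` and equal to `1` on `{ξ : |ξ_i| ≤ 1/2 for all i}`. -/
structure IsWindow {n : ℕ} (ρ : EuclideanSpace ℝ (Fin n) → ℝ) : Prop where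
  contDiff : ContDiff ℝ (⊤ : ℕ∞) ρ
  nonneg : ∀ ξ, 0 ≤ ρ ξ
  le_one : ∀ ξ, ρ ξ ≤ 1
  tsupport_subset : tsupport ρ ⊆ {ξ | ∀ i, |ξ i| ≤ 1}
  eq_one : ∀ ξ, (∀ i, |ξ i| ≤ 1 / 2) → ρ ξ = 1

/-- The uniform decomposition of unity associated with `ρ`:
`σ_k(ξ) = ρ(ξ - k) / ∑_{l ∈ ℤⁿ} ρ(ξ - l)`. -/
def sigma {n : ℕ} (ρ : EuclideanSpace ℝ (Fin n) → ℝ) (k : Fin n → ℤ)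
    (ξ : EuclideanSpace ℝ (Fin n)) : ℝ :=
  ρ (ξ - latticePoint k) / ∑' l : Fin n → ℤ, ρ (ξ - latticePoint l)

theorem finite_near {n : ℕ} {ρ : EuclideanSpace ℝ (Fin n) → ℝ} (hρ : IsWindow ρ)
    (ξ₀ : EuclideanSpace ℝ (Fin n)) :
    {l : Fin n → ℤ | ∃ ξ ∈ Metric.ball ξ₀ 1, ρ (ξ - latticePoint l) ≠ 0}.Finite := by
  refine (Set.finite_Icc (fun i => ⌊ξ₀ i⌋ - 3) (fun i => ⌊ξ₀ i⌋ + 3)).subset ?_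
  rintro l ⟨ξ, hξ, hl⟩
  have h1 := hρ.tsupport_subset (subset_tsupport ρ hl)
  have h2 : ∀ i, |ξ i - ξ₀ i| < 1 := fun i => by
    have := PiLp.norm_apply_le (ξ - ξ₀) i
    rw [Metric.mem_ball, dist_eq_norm] at hξ
    simp only [PiLp.sub_apply, Real.norm_eq_abs] at this
    linarith
  have key : ∀ i, ⌊ξ₀ i⌋ - 3 ≤ l i ∧ l i ≤ ⌊ξ₀ i⌋ + 3 := fun i => by
    have a := h1 i
    have b := h2 i
    simp only [latticePoint, PiLp.sub_apply, abs_le] at a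
    rw [abs_lt] at b
    have f1 := Int.floor_le (ξ₀ i)
    have f2 := Int.lt_floor_add_one (ξ₀ i)
    constructor
    · have : ((⌊ξ₀ i⌋ - 3 : ℤ) : ℝ) ≤ (l i : ℝ) := by push_cast; linarith [a.1, a.2]
      exact_mod_cast this
    · have : (l i : ℝ) ≤ ((⌊ξ₀ i⌋ + 3 : ℤ) : ℝ) := by push_cast; linarith [a.1, a.2]
      exact_mod_cast this
  exact ⟨fun i => (key i).1, fun i => (key i).2⟩

theorem summable_window {n : ℕ} {ρ : EuclideanSpace ℝ (Fin n) → ℝ} (hρ : IsWindow ρ)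
    (ξ : EuclideanSpace ℝ (Fin n)) :
    Summable (fun l : Fin n → ℤ => ρ (ξ - latticePoint l)) := by
  refine summable_of_hasFiniteSupport ((finite_near hρ ξ).subset fun l hl => ?_)
  exact ⟨ξ, Metric.mem_ball_self one_pos, hl⟩

theorem one_le_tsum_window {n : ℕ} {ρ : EuclideanSpace ℝ (Fin n) → ℝ} (hρ : IsWindow ρ)
    (ξ : EuclideanSpace ℝ (Fin n)) : 1 ≤ ∑' l : Fin n → ℤ, ρ (ξ - latticePoint l) := by
  have h : ρ (ξ - latticePoint fun i => round (ξ i)) = 1 :=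
    hρ.eq_one _ fun i => by simpa [latticePoint] using abs_sub_round (ξ i)
  rw [← h]
  exact (summable_window hρ ξ).le_tsum (fun i => round (ξ i)) fun l _ => hρ.nonneg _

theorem contDiff_tsum_window {n : ℕ} {ρ : EuclideanSpace ℝ (Fin n) → ℝ} (hρ : IsWindow ρ) :
    ContDiff ℝ (⊤ : ℕ∞) fun ξ => ∑' l : Fin n → ℤ, ρ (ξ - latticePoint l) := by
  refine contDiff_iff_contDiffAt.2 fun ξ₀ => ?_
  have hs : ContDiffAt ℝ (⊤ : ℕ∞)
      (fun ξ => ∑ l ∈ (finite_near hρ ξ₀).toFinset, ρ (ξ - latticePoint l)) ξ₀ :=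
    ContDiffAt.sum fun l _ => (hρ.contDiff.comp (contDiff_id.sub contDiff_const)).contDiffAt
  refine hs.congr_of_eventuallyEq ?_
  filter_upwards [Metric.ball_mem_nhds ξ₀ one_pos] with ξ hξ
  refine tsum_eq_sum fun l hl => ?_
  by_contra h
  exact hl ((finite_near hρ ξ₀).mem_toFinset.2 ⟨ξ, hξ, h⟩)

theorem hasCompactSupport_window {n : ℕ} {ρ : EuclideanSpace ℝ (Fin n) → ℝ} (hρ : IsWindow ρ) :
    HasCompactSupport ρ := by
  refine Metric.isCompact_of_isClosed_isBounded (isClosed_tsupport ρ) ?_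
  refine (Metric.isBounded_closedBall (x := (0 : EuclideanSpace ℝ (Fin n))) (r := √n)).subset
    fun ξ hξ => ?_
  have h := hρ.tsupport_subset hξ
  rw [mem_closedBall_zero_iff, EuclideanSpace.norm_eq]
  refine Real.sqrt_le_sqrt ?_
  calc ∑ i, ‖ξ i‖ ^ 2 ≤ ∑ _i : Fin n, (1 : ℝ) :=
        Finset.sum_le_sum fun i _ => pow_le_one₀ (norm_nonneg _) (h i)
    _ = n := by simp

/-- The multiplier that defines `box` is smooth with compact support, so that Mathlib's Fourier
multiplier operator applies to it. -/
theorem hasTemperateGrowth_multiplier {n : ℕ} {ρ : EuclideanSpace ℝ (Fin n) → ℝ}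
    (hρ : IsWindow ρ) (k : Fin n → ℤ) :
    (fun η : EuclideanSpace ℝ (Fin n) =>
      ((sigma ρ k ((2 * Real.pi) • η) : ℝ) : ℂ)).HasTemperateGrowth := by
  have hsm : ContDiff ℝ (⊤ : ℕ∞) (sigma ρ k) :=
    (hρ.contDiff.comp (contDiff_id.sub contDiff_const)).div (contDiff_tsum_window hρ)
      fun ξ => (lt_of_lt_of_le one_pos (one_le_tsum_window hρ ξ)).ne'
  have hc : HasCompactSupport (sigma ρ k) := by
    have h1 : HasCompactSupport fun ξ => ρ (ξ - latticePoint k) :=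
      (hasCompactSupport_window hρ).comp_homeomorph (Homeomorph.subRight (latticePoint k))
    refine h1.mono fun ξ hξ h => hξ ?_
    simp only at h
    simp [sigma, h]
  have hc2 : HasCompactSupport fun η : EuclideanSpace ℝ (Fin n) =>
      sigma ρ k ((2 * Real.pi) • η) :=
    hc.comp_homeomorph (Homeomorph.smulOfNeZero (2 * Real.pi) Real.two_pi_pos.ne')
  have hs2 : ContDiff ℝ (⊤ : ℕ∞) fun η : EuclideanSpace ℝ (Fin n) =>
      sigma ρ k ((2 * Real.pi) • η) := hsm.comp (contDiff_const_smul _)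
  exact (hc2.comp_left (g := Complex.ofReal) Complex.ofReal_zero).hasTemperateGrowth
    (Complex.ofRealCLM.contDiff.comp hs2)

/-- The uniform decomposition operator `□_k = F⁻¹ (σ_k F ·)` on tempered distributions.
Here `F` is the Fourier transform with kernel `(2π)^{-n/2} e^{-i x·ξ}`. Mathlib's transform `𝓕`
has kernel `e^{-2π i x·η}`, so `F f (ξ) = (2π)^{-n/2} 𝓕 f (ξ / 2π)`, and the multiplier `σ_k(ξ)`
with respect to `F` is the multiplier `σ_k(2πη)` with respect to `𝓕`. -/
def box {n : ℕ} (ρ : EuclideanSpace ℝ (Fin n) → ℝ) (k : Fin n → ℤ)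
    (T : 𝓢'(EuclideanSpace ℝ (Fin n), ℂ)) : 𝓢'(EuclideanSpace ℝ (Fin n), ℂ) :=
  TemperedDistribution.fourierMultiplierCLM ℂ
    (fun η => ((sigma ρ k ((2 * Real.pi) • η) : ℝ) : ℂ)) T

/-- The `L^p` norm of a tempered distribution: the norm of the (unique) `L^p` function that
represents it, and `∞` if there is none. -/
def lpENorm {n : ℕ} (p : ℝ≥0∞) [Fact (1 ≤ p)] (T : 𝓢'(EuclideanSpace ℝ (Fin n), ℂ)) : ℝ≥0∞ :=
  ⨅ (g : Lp ℂ p (volume : Measure (EuclideanSpace ℝ (Fin n))))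
    (_ : Lp.toTemperedDistribution g = T), ‖g‖ₑ

/-- The term `e^{|k|^{1/s}} ‖□_k T‖_{L^p}`. -/
def gmTerm {n : ℕ} (s : ℝ) (p : ℝ≥0∞) [Fact (1 ≤ p)] (ρ : EuclideanSpace ℝ (Fin n) → ℝ)
    (T : 𝓢'(EuclideanSpace ℝ (Fin n), ℂ)) (k : Fin n → ℤ) : ℝ≥0∞ :=
  ENNReal.ofReal (Real.exp (‖latticePoint k‖ ^ (1 / s))) * lpENorm p (box ρ k T)

/-- The Gevrey-modulation norm of a tempered distribution, with values in `[0,∞]`. -/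
def gmENorm {n : ℕ} (s : ℝ) (p q : ℝ≥0∞) [Fact (1 ≤ p)] (ρ : EuclideanSpace ℝ (Fin n) → ℝ)
    (T : 𝓢'(EuclideanSpace ℝ (Fin n), ℂ)) : ℝ≥0∞ :=
  if q = ∞ then ⨆ k : Fin n → ℤ, gmTerm s p ρ T k
  else (∑' k : Fin n → ℤ, gmTerm s p ρ T k ^ q.toReal) ^ (1 / q.toReal)

open scoped Classical in
/-- The Gevrey-modulation norm of a function, with values in `[0,∞]`: it is `∞` for a function
that is not in `L^p`. -/
def gmENormFun {n : ℕ} (s : ℝ) (p q : ℝ≥0∞) [Fact (1 ≤ p)] (ρ : EuclideanSpace ℝ (Fin n) → ℝ)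
    (f : EuclideanSpace ℝ (Fin n) → ℂ) : ℝ≥0∞ :=
  if hf : MemLp f p volume then gmENorm s p q ρ (Lp.toTemperedDistribution (hf.toLp f)) else ∞

/-- `f` belongs to the Gevrey-modulation space `GM^s_{p,q}(ℝⁿ)`: it is in `L^p` and its
Gevrey-modulation norm is finite. -/
def MemGM {n : ℕ} (s : ℝ) (p q : ℝ≥0∞) [Fact (1 ≤ p)] (ρ : EuclideanSpace ℝ (Fin n) → ℝ)
    (f : EuclideanSpace ℝ (Fin n) → ℂ) : Prop :=
  MemLp f p volume ∧ gmENormFun s p q ρ f < ∞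

/-- The Gevrey-modulation norm `‖f‖_{GM^s_{p,q}}` as a real number. -/
def gmNorm {n : ℕ} (s : ℝ) (p q : ℝ≥0∞) [Fact (1 ≤ p)] (ρ : EuclideanSpace ℝ (Fin n) → ℝ)
    (f : EuclideanSpace ℝ (Fin n) → ℂ) : ℝ :=
  (gmENormFun s p q ρ f).toReal

end GevreyModulation

end

noncomputable section

namespace GevreyModulation

/-! ### Countable subadditivity and convolutions in `L^p` -/

/-! Put α = 1/s < 1 and let N be the norm of u. Each □_k is a convolution with a kernel whose
modulus does not depend on k. Hence ‖□_k f‖_∞ ≲ ‖□_k f‖_p uniformly in k (`enorm_bx_le_eLpNorm_bx`),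
and □_k(□_l f · □_m g) vanishes unless k - l - m lies in a fixed cube (`bx_mul_bx_eq_zero`).
Concavity gives (a+b)^α ≤ a^α + b^α - 2g min(a,b)^α with g = `gain α` > 0. Since exp(-g|k|^α) is
summable over ℤⁿ, the weighted ℓ^q norm is submultiplicative up to a constant for every q ≥ 1
(`wNorm_mul_le`). The power series then bounds e^{if} - 1 by ‖f‖ e^{C‖f‖} (`wNorm_exp_sub_one_le`),
which is too large when applied to u itself.

To reach the exponent N^α log N for large N, the function u = v + w is split at |k| = R, with
e^{-gR^α} of order 1/N.

High frequencies: in the weight exp(max(|k|,R)^α) the norm of w is still ≲ N, but the algebra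
constant acquires the factor e^{-gR^α}. The series for e^{iw} - 1 therefore costs only a bounded
factor, and |w| ≤ 1 almost everywhere (`wNorm_exp_high_le`).

Low frequencies: in the weight exp(|k|/R + |k|^α) the norm of v is ≲ N, and the series gives a bound
of order N e^{LN}. The additional weight compensates e^{LN} once |k| ≥ K = LNR. For |k| ≤ K the
pointwise bound |e^{iv} - 1| ≤ 5|v| is enough, at the price e^{2K^α} (`wNorm_exp_low_le`). Here the
reality of u enters, through |Im v| = |Im w| ≤ 1. Since R^α is of order log N, K^α is of order N^α
log N.

With A = e^{iv} - 1 and B = e^{iw} - 1, the two parts recombine as e^{iu} - 1 = AB + A + B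
(`wNorm_exp_sub_one_le_of_real`). -/

theorem eLpNorm_tsum_le {α ι : Type*} [MeasurableSpace α] {μ : Measure α} [Countable ι]
    {f : ι → α → ℝ≥0∞} (hf : ∀ i, AEMeasurable (f i) μ) {p : ℝ≥0∞} (hp : 1 ≤ p) :
    eLpNorm (fun x => ∑' i, f i x) p μ ≤ ∑' i, eLpNorm (f i) p μ := by
  have hp0 : p ≠ 0 := (zero_lt_one.trans_le hp).ne'
  rcases eq_or_ne p ∞ with rfl | hp1
  · simp only [eLpNorm_exponent_top]
    refine essSup_le_of_ae_le _ ?_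
    filter_upwards [ae_all_iff.2 fun i => ae_le_eLpNormEssSup (f := f i) (μ := μ)] with x hx
    exact ENNReal.tsum_le_tsum hx
  have hp2 : 0 < p.toReal := ENNReal.toReal_pos hp0 hp1
  have key : ∀ s : Finset ι, ∫⁻ x, (∑ i ∈ s, f i x) ^ p.toReal ∂μ
      ≤ (∑' i, eLpNorm (f i) p μ) ^ p.toReal := fun s => by
    have h := (eLpNorm_sum_le (fun i (_ : i ∈ s) => (hf i).aestronglyMeasurable) hp).trans
      (ENNReal.sum_le_tsum s)
    rw [eLpNorm_eq_lintegral_rpow_enorm_toReal hp0 hp1] at h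
    have := ENNReal.rpow_le_rpow h hp2.le
    rw [← ENNReal.rpow_mul, one_div_mul_cancel hp2.ne', ENNReal.rpow_one] at this
    simpa using this
  rw [eLpNorm_eq_lintegral_rpow_enorm_toReal hp0 hp1, one_div, ENNReal.rpow_inv_le_iff hp2]
  -- Minkowski for finite sums passes to the countable sum by monotone convergence along the
  -- directed family of partial sums.
  calc ∫⁻ x, ‖∑' i, f i x‖ₑ ^ p.toReal ∂μ
      = ∫⁻ x, ⨆ s : Finset ι, (∑ i ∈ s, f i x) ^ p.toReal ∂μ := by
        congr 1 with x
        rw [enorm_eq_self, ENNReal.tsum_eq_iSup_sum]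
        exact (ENNReal.orderIsoRpow p.toReal hp2).map_iSup _
    _ = ⨆ s : Finset ι, ∫⁻ x, (∑ i ∈ s, f i x) ^ p.toReal ∂μ := by
        refine lintegral_iSup_directed
          (fun s => (Finset.aemeasurable_fun_sum s fun i _ => hf i).pow_const _) ?_
        classical
        refine Monotone.directed_le fun s t hst x => ?_
        exact ENNReal.rpow_le_rpow (Finset.sum_le_sum_of_subset hst) hp2.le
    _ ≤ _ := iSup_le key

theorem eLpNorm_le_tsum_of_hasSum {α ι : Type*} [MeasurableSpace α] {μ : Measure α} [Countable ι]
    {f : ι → α → ℂ} {F : α → ℂ} (hf : ∀ i, AEStronglyMeasurable (f i) μ) {p : ℝ≥0∞} (hp : 1 ≤ p)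
    (h : ∀ᵐ x ∂μ, HasSum (fun i => f i x) (F x)) :
    eLpNorm F p μ ≤ ∑' i, eLpNorm (f i) p μ := by
  calc eLpNorm F p μ ≤ eLpNorm (fun x => ∑' i, ‖f i x‖ₑ) p μ := by
        refine eLpNorm_mono_enorm_ae ?_
        filter_upwards [h] with x hx
        rw [enorm_eq_self, ← hx.tsum_eq]
        exact enorm_tsum_le_tsum_enorm
    _ ≤ ∑' i, eLpNorm (fun x => ‖f i x‖ₑ) p μ := eLpNorm_tsum_le (fun i => (hf i).enorm) hp
    _ = _ := by simp only [eLpNorm_enorm]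

/-- Young's inequality with an L^1 factor: Hölder for the measure c(x - y) dy, whose mass does not
depend on x, followed by Tonelli. -/
theorem eLpNorm_lconvolution_le {n : ℕ} {c f : EuclideanSpace ℝ (Fin n) → ℝ≥0∞}
    (hc : Measurable c) (hf : AEMeasurable f) {p : ℝ≥0∞} (hp : 1 ≤ p) (hp1 : p ≠ ∞) :
    eLpNorm (fun x => ∫⁻ y, c (x - y) * f y) p volume ≤ (∫⁻ y, c y) * eLpNorm f p volume := by
  have hp0 : p ≠ 0 := (zero_lt_one.trans_le hp).ne'
  have hp2 : 0 < p.toReal := ENNReal.toReal_pos hp0 hp1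
  set C := ∫⁻ y, c y
  have hcx : ∀ x, Measurable fun y => c (x - y) := fun x => hc.comp (measurable_const_sub x)
  have hCx : ∀ x, ∫⁻ y, c (x - y) = C := fun x => lintegral_sub_left_eq_self c x
  have h1 : ∀ x, (∫⁻ y, c (x - y) * f y) ^ p.toReal
      ≤ C ^ (p.toReal - 1) * ∫⁻ y, c (x - y) * f y ^ p.toReal := fun x => by
    set ν := (volume : Measure (EuclideanSpace ℝ (Fin n))).withDensity fun y => c (x - y)
    have hν : ∀ g : EuclideanSpace ℝ (Fin n) → ℝ≥0∞, AEMeasurable g →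
        ∫⁻ y, g y ∂ν = ∫⁻ y, c (x - y) * g y := fun g hg => by
      rw [lintegral_withDensity_eq_lintegral_mul₀ (hcx x).aemeasurable hg]; rfl
    have hfν : AEMeasurable f ν := hf.mono_ac (withDensity_absolutelyContinuous _ _)
    have h := eLpNorm_le_eLpNorm_mul_rpow_measure_univ (μ := ν) hp hfν.aestronglyMeasurable
    rw [eLpNorm_one_eq_lintegral_enorm, eLpNorm_eq_lintegral_rpow_enorm_toReal hp0 hp1] at h
    simp only [enorm_eq_self] at h
    rw [hν f hf, hν _ (hf.pow_const _), withDensity_apply _ MeasurableSet.univ,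
      Measure.restrict_univ, hCx] at h
    refine (ENNReal.rpow_le_rpow h hp2.le).trans_eq ?_
    rw [ENNReal.mul_rpow_of_nonneg _ _ hp2.le, ← ENNReal.rpow_mul, one_div_mul_cancel hp2.ne',
      ENNReal.rpow_one, ← ENNReal.rpow_mul, mul_comm]
    congr 2
    simp only [ENNReal.toReal_one]
    field_simp
  rw [eLpNorm_eq_lintegral_rpow_enorm_toReal hp0 hp1, one_div, ENNReal.rpow_inv_le_iff hp2]
  simp only [enorm_eq_self]
  have hm : AEMeasurable (Function.uncurry fun x y : EuclideanSpace ℝ (Fin n) =>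
      c (x - y) * f y ^ p.toReal) (volume.prod volume) :=
    (hc.comp (measurable_fst.sub measurable_snd)).aemeasurable.mul
      ((hf.comp_snd (μ := volume)).pow_const _)
  calc ∫⁻ x, (∫⁻ y, c (x - y) * f y) ^ p.toReal
      ≤ ∫⁻ x, C ^ (p.toReal - 1) * ∫⁻ y, c (x - y) * f y ^ p.toReal := lintegral_mono h1
    _ = C ^ (p.toReal - 1) * ∫⁻ x, ∫⁻ y, c (x - y) * f y ^ p.toReal :=
        lintegral_const_mul'' _ hm.lintegral_prod_right'
    _ = C ^ (p.toReal - 1) * ∫⁻ y, ∫⁻ x, c (x - y) * f y ^ p.toReal := by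
        rw [lintegral_lintegral_swap hm]
    _ = C ^ (p.toReal - 1) * (C * ∫⁻ y, f y ^ p.toReal) := by
        congr 1
        rw [← lintegral_const_mul'' _ (hf.pow_const _)]
        congr 1 with y
        rw [lintegral_mul_const _ (show Measurable fun x => c (x - y) from
          hc.comp (measurable_sub_const y)), lintegral_sub_right_eq_self c y]
    _ = (C * eLpNorm f p volume) ^ p.toReal := by
        rw [ENNReal.mul_rpow_of_nonneg _ _ hp2.le, eLpNorm_eq_lintegral_rpow_enorm_toReal hp0 hp1,
          ← ENNReal.rpow_mul, one_div_mul_cancel hp2.ne', ENNReal.rpow_one, ← mul_assoc]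
        simp only [enorm_eq_self]
        congr 1
        have h1p : 1 ≤ p.toReal := by
          rwa [← ENNReal.toReal_one, ENNReal.toReal_le_toReal ENNReal.one_ne_top hp1]
        conv_rhs => rw [← sub_add_cancel p.toReal 1]
        rw [ENNReal.rpow_add_of_nonneg _ _ (by linarith) zero_le_one, ENNReal.rpow_one]

/-! ### The sequence spaces `ℓ^q` -/

/-- The `ℓ^q` norm of a family of extended nonnegative reals. -/
def lq {ι : Type*} (q : ℝ≥0∞) (a : ι → ℝ≥0∞) : ℝ≥0∞ :=
  if q = ∞ then ⨆ k, a k else (∑' k, a k ^ q.toReal) ^ (1 / q.toReal)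

section

variable {ι : Type*} {q : ℝ≥0∞}

theorem lq_eq_eLpNorm [MeasurableSpace ι] [DiscreteMeasurableSpace ι] (hq : q ≠ 0)
    (a : ι → ℝ≥0∞) : lq q a = eLpNorm a q Measure.count := by
  rcases eq_or_ne q ∞ with rfl | h
  · simp [lq, eLpNormEssSup]
  · rw [lq, if_neg h, eLpNorm_eq_lintegral_rpow_enorm_toReal hq h, lintegral_count]
    simp

/-- The ℓ^q norm is the L^q norm of the counting measure, so this is Minkowski again, with q = ∞
included. -/
theorem lq_tsum_le [Countable ι] {κ : Type*} [Countable κ] (hq : 1 ≤ q) (a : κ → ι → ℝ≥0∞) :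
    lq q (fun k => ∑' i, a i k) ≤ ∑' i, lq q (a i) := by
  let _ : MeasurableSpace ι := ⊤
  have hq0 : q ≠ 0 := (zero_lt_one.trans_le hq).ne'
  simp_rw [lq_eq_eLpNorm hq0]
  exact eLpNorm_tsum_le (fun i => (Measurable.of_discrete).aemeasurable) hq

theorem lq_mono {a b : ι → ℝ≥0∞} (h : ∀ k, a k ≤ b k) : lq q a ≤ lq q b := by
  unfold lq
  split_ifs
  · exact iSup_mono h
  · exact ENNReal.rpow_le_rpow (ENNReal.tsum_le_tsum fun k =>
      ENNReal.rpow_le_rpow (h k) ENNReal.toReal_nonneg) (by positivity)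

theorem lq_const_mul (hq : 1 ≤ q) (c : ℝ≥0∞) (a : ι → ℝ≥0∞) :
    lq q (fun k => c * a k) = c * lq q a := by
  unfold lq
  split_ifs with h
  · rw [ENNReal.mul_iSup]
  · have hq2 : 0 < q.toReal := ENNReal.toReal_pos (zero_lt_one.trans_le hq).ne' h
    simp_rw [ENNReal.mul_rpow_of_nonneg _ _ hq2.le]
    rw [ENNReal.tsum_mul_left, ENNReal.mul_rpow_of_nonneg _ _ (by positivity),
      ← ENNReal.rpow_mul, mul_one_div_cancel hq2.ne', ENNReal.rpow_one]

theorem lq_comp_equiv {κ : Type*} (e : κ ≃ ι) (a : ι → ℝ≥0∞) :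
    lq q (fun k => a (e k)) = lq q a := by
  unfold lq
  rw [e.iSup_comp, e.tsum_eq fun k => a k ^ q.toReal]

theorem le_lq (hq : 1 ≤ q) (a : ι → ℝ≥0∞) (k : ι) : a k ≤ lq q a := by
  unfold lq
  split_ifs with h
  · exact le_iSup a k
  · have hq2 : 0 < q.toReal := ENNReal.toReal_pos (zero_lt_one.trans_le hq).ne' h
    rw [one_div, ENNReal.le_rpow_inv_iff hq2]
    exact ENNReal.le_tsum k

theorem lq_add_le [Countable ι] (hq : 1 ≤ q) (a b : ι → ℝ≥0∞) :
    lq q (fun k => a k + b k) ≤ lq q a + lq q b := by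
  have := lq_tsum_le hq (fun i : Bool => if i then a else b)
  simpa [tsum_fintype] using this

/-- Decompose the family into its one-point parts and apply the triangle inequality. -/
theorem lq_le_tsum [Countable ι] (hq : 1 ≤ q) (a : ι → ℝ≥0∞) : lq q a ≤ ∑' k, a k := by
  classical
  have hq0 : (0 : ℝ≥0∞) < q := zero_lt_one.trans_le hq
  have h1 : ∀ i, lq q (fun k => if k = i then a i else 0) ≤ a i := fun i => by
    unfold lq
    split_ifs with h
    · exact iSup_le fun k => by by_cases hk : k = i <;> simp [hk]
    · have hq2 : 0 < q.toReal := ENNReal.toReal_pos hq0.ne' h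
      rw [tsum_eq_single i fun k hk => by simp [hk, hq2]]
      simp only [if_true]
      rw [← ENNReal.rpow_mul,
        mul_one_div_cancel hq2.ne', ENNReal.rpow_one]
  calc lq q a = lq q fun k => ∑' i, if k = i then a i else 0 := by simp
    _ ≤ ∑' i, lq q (fun k => if k = i then a i else 0) := lq_tsum_le hq _
    _ ≤ _ := ENNReal.tsum_le_tsum h1

theorem lq_sum_le [Countable ι] {κ : Type*} (hq : 1 ≤ q) (s : Finset κ) (a : κ → ι → ℝ≥0∞) :
    lq q (fun k => ∑ i ∈ s, a i k) ≤ ∑ i ∈ s, lq q (a i) := by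
  have := lq_tsum_le hq (fun i : s => a i)
  simp only [tsum_fintype] at this
  rw [Finset.sum_coe_sort s (fun i => lq q (a i))] at this
  refine (lq_mono fun k => ?_).trans this
  exact (Finset.sum_coe_sort s fun i => a i k).ge

end

end GevreyModulation

end

noncomputable section

namespace GevreyModulation

open FourierTransform
open scoped Real RealInnerProductSpace

/-- The `n`-dimensional Euclidean space. -/
abbrev Space (n : ℕ) := EuclideanSpace ℝ (Fin n)

/-! ### Fourier integrals of integrable functions -/

theorem fourierInv_eq_mul {n : ℕ} (f : Space n → ℂ) (w : Space n) :
    𝓕⁻ f w = ∫ v, (𝐞 ⟪v, w⟫ : ℂ) * f v := by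
  simp [Real.fourierInv_eq, Circle.smul_def]

theorem fourier_eq_mul {n : ℕ} (f : Space n → ℂ) (w : Space n) :
    𝓕 f w = ∫ v, (𝐞 (-⟪v, w⟫) : ℂ) * f v := by
  simp [Real.fourier_eq, Circle.smul_def]

theorem fourierChar_add_coe (a b : ℝ) : (𝐞 (a + b) : ℂ) = 𝐞 a * 𝐞 b := by
  rw [AddChar.map_add_eq_mul, Circle.coe_mul]

theorem continuous_fourierChar_coe {X : Type*} [TopologicalSpace X] {f : X → ℝ}
    (hf : Continuous f) : Continuous fun x => (𝐞 (f x) : ℂ) :=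
  continuous_subtype_val.comp (Real.continuous_fourierChar.comp hf)

theorem integral_fourier_mul_eq {n : ℕ} {f g : Space n → ℂ} (hf : Integrable f)
    (hg : Integrable g) : ∫ ξ, 𝓕 f ξ * g ξ = ∫ x, f x * 𝓕 g x := by
  simpa using! VectorFourier.integral_fourierIntegral_smul_eq_flip (L := innerₗ (Space n))
    Real.continuous_fourierChar continuous_inner hf hg

theorem integral_fourierInv_mul_eq {n : ℕ} {f g : Space n → ℂ} (hf : Integrable f)
    (hg : Integrable g) : ∫ ξ, 𝓕⁻ f ξ * g ξ = ∫ x, f x * 𝓕⁻ g x := by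
  have h := integral_fourier_mul_eq hf.comp_neg hg
  rw [← Real.fourierInv_eq_fourier_comp_neg] at h
  rw [h, ← integral_neg_eq_self]
  simp [Real.fourierInv_eq_fourier_neg]

theorem integrable_fourierChar_mul {n : ℕ} {f : Space n → ℂ} (hf : Integrable f)
    {φ : Space n → ℝ} (hφ : Continuous φ) : Integrable fun x => (𝐞 (φ x) : ℂ) * f x :=
  hf.bdd_mul (c := 1) (continuous_fourierChar_coe hφ).aestronglyMeasurable
    (Filter.Eventually.of_forall fun _ => (Circle.norm_coe _).le)

/-- Transposition of a multiplier: pairing with a translated kernel becomes the Fourier integral of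
a product on the frequency side. Support properties of the multipliers thereby turn into vanishing
and reproducing identities for the kernels. -/
theorem integral_mul_fourierInv_sub {n : ℕ} {θ m : Space n → ℂ} (hθ : Integrable θ)
    (hm : Integrable m) (y : Space n) :
    ∫ x, θ x * 𝓕⁻ m (x - y) = 𝓕 (fun η => m η * 𝓕⁻ θ η) y := by
  have h1 : ∀ x, 𝓕⁻ m (x - y) = 𝓕⁻ (fun η => (𝐞 (-⟪η, y⟫) : ℂ) * m η) x := fun x => by
    rw [fourierInv_eq_mul, fourierInv_eq_mul]
    congr 1 with η
    rw [← mul_assoc, ← fourierChar_add_coe, inner_sub_right, sub_eq_add_neg]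
  simp_rw [h1]
  rw [← integral_fourierInv_mul_eq hθ (integrable_fourierChar_mul hm (by fun_prop)),
    fourier_eq_mul]
  congr 1 with η
  ring

/-! ### The multipliers and their kernels -/

/-- The multiplier of `□_k` with respect to the Fourier transform with kernel `e^{-2πix·η}`. -/
def mult {n : ℕ} (ρ : Space n → ℝ) (k : Fin n → ℤ) (η : Space n) : ℂ :=
  ((sigma ρ k ((2 * π) • η) : ℝ) : ℂ)

/-- The convolution kernel of `□_k`. -/
def ker {n : ℕ} (ρ : Space n → ℝ) (k : Fin n → ℤ) : Space n → ℂ := 𝓕⁻ (mult ρ k)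

/-- The cube `{k ∈ ℤⁿ : |k_i| ≤ r}`. -/
def cube (n r : ℕ) : Finset (Fin n → ℤ) := Finset.Icc (fun _ => -(r : ℤ)) (fun _ => (r : ℤ))

theorem mem_cube {n r : ℕ} {k : Fin n → ℤ} : k ∈ cube n r ↔ ∀ i, |k i| ≤ r := by
  simp only [cube, Finset.mem_Icc, Pi.le_def, abs_le, forall_and]

section

variable {n : ℕ} {ρ : Space n → ℝ}

theorem latticePoint_apply (k : Fin n → ℤ) (i : Fin n) : latticePoint k i = k i := rfl

theorem latticePoint_add (k l : Fin n → ℤ) :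
    latticePoint (k + l) = latticePoint k + latticePoint l := by
  ext i; simp [latticePoint_apply]

theorem latticePoint_sub (k l : Fin n → ℤ) :
    latticePoint (k - l) = latticePoint k - latticePoint l := by
  ext i; simp [latticePoint_apply]

theorem latticePoint_zero : latticePoint (0 : Fin n → ℤ) = 0 := by
  ext i; simp [latticePoint_apply]

theorem sigma_eq_zero (hρ : IsWindow ρ) {k : Fin n → ℤ} {ξ : Space n}
    (h : ¬ ∀ i, |ξ i - k i| ≤ 1) : sigma ρ k ξ = 0 := by
  have : ρ (ξ - latticePoint k) = 0 := by
    by_contra h0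
    exact h fun i => by simpa [latticePoint_apply] using hρ.tsupport_subset (subset_tsupport ρ h0) i
  simp [sigma, this]

theorem hasSum_sigma (hρ : IsWindow ρ) (ξ : Space n) : HasSum (fun k => sigma ρ k ξ) 1 := by
  have h := (summable_window hρ ξ).hasSum.div_const (∑' l : Fin n → ℤ, ρ (ξ - latticePoint l))
  rwa [div_self (lt_of_lt_of_le one_pos (one_le_tsum_window hρ ξ)).ne'] at h

/-- The denominator is invariant under integer translations, so all multipliers are translates of
one another. -/
theorem sigma_shift (ρ : Space n → ℝ) (k l : Fin n → ℤ) (ξ : Space n) :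
    sigma ρ (k + l) (ξ + latticePoint l) = sigma ρ k ξ := by
  have h : ∑' j : Fin n → ℤ, ρ (ξ + latticePoint l - latticePoint j)
      = ∑' j : Fin n → ℤ, ρ (ξ - latticePoint j) := by
    rw [← (Equiv.addRight l).tsum_eq]
    simp [latticePoint_add]
  rw [sigma, sigma, h, latticePoint_add]
  simp

theorem mult_eq_zero (hρ : IsWindow ρ) {k : Fin n → ℤ} {η : Space n}
    (h : ¬ ∀ i, |2 * π * η i - k i| ≤ 1) : mult ρ k η = 0 := by
  rw [mult, sigma_eq_zero hρ (by simpa using h), Complex.ofReal_zero]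

theorem le_one_of_mult_ne_zero (hρ : IsWindow ρ) {k : Fin n → ℤ} {η : Space n}
    (h : mult ρ k η ≠ 0) (i : Fin n) : |2 * π * η i - k i| ≤ 1 := by
  by_contra h'
  exact h (mult_eq_zero hρ fun h0 => h' (h0 i))

theorem hasSum_mult (hρ : IsWindow ρ) (η : Space n) : HasSum (fun k => mult ρ k η) 1 := by
  simpa [mult] using! Complex.hasSum_ofReal.2 (hasSum_sigma hρ ((2 * π) • η))

theorem hasCompactSupport_mult (hρ : IsWindow ρ) (k : Fin n → ℤ) :
    HasCompactSupport (mult ρ k) := by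
  refine HasCompactSupport.of_support_subset_isCompact
    (isCompact_closedBall (0 : Space n) (√(∑ i, (|(k i : ℝ)| + 1) ^ 2))) fun η hη => ?_
  rw [mem_closedBall_zero_iff, EuclideanSpace.norm_eq]
  refine Real.sqrt_le_sqrt (Finset.sum_le_sum fun i _ => ?_)
  refine pow_le_pow_left₀ (norm_nonneg _) ?_ 2
  have h := le_one_of_mult_ne_zero hρ hη i
  have h1 : |2 * π * η i| ≤ |(k i : ℝ)| + 1 := by
    calc |2 * π * η i| = |(k i : ℝ) + (2 * π * η i - k i)| := by ring_nf
      _ ≤ _ := (abs_add_le _ _).trans (by linarith)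
  rw [abs_mul, abs_of_pos Real.two_pi_pos] at h1
  have : 1 ≤ 2 * π := by linarith [Real.pi_gt_three]
  exact (le_mul_of_one_le_left (abs_nonneg _) this).trans h1

theorem contDiff_mult (hρ : IsWindow ρ) (k : Fin n → ℤ) :
    ContDiff ℝ (⊤ : ℕ∞) (mult ρ k) := (hasTemperateGrowth_multiplier hρ k).1

/-- The multiplier of `□_k` as a Schwartz function. -/
def multSchwartz (hρ : IsWindow ρ) (k : Fin n → ℤ) : 𝓢(Space n, ℂ) :=
  (hasCompactSupport_mult hρ k).toSchwartzMap (contDiff_mult hρ k)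

theorem coe_multSchwartz (hρ : IsWindow ρ) (k : Fin n → ℤ) :
    ⇑(multSchwartz hρ k) = mult ρ k := rfl

theorem ker_eq_coe (hρ : IsWindow ρ) (k : Fin n → ℤ) :
    ker ρ k = ⇑(𝓕⁻ (multSchwartz hρ k) : 𝓢(Space n, ℂ)) := by
  rw [SchwartzMap.fourierInv_coe, coe_multSchwartz, ker]

theorem continuous_ker (hρ : IsWindow ρ) (k : Fin n → ℤ) : Continuous (ker ρ k) := by
  rw [ker_eq_coe hρ]; exact SchwartzMap.continuous _

theorem integrable_ker (hρ : IsWindow ρ) (k : Fin n → ℤ) : Integrable (ker ρ k) := by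
  rw [ker_eq_coe hρ]; exact SchwartzMap.integrable _

theorem memLp_ker (hρ : IsWindow ρ) (k : Fin n → ℤ) (p : ℝ≥0∞) : MemLp (ker ρ k) p := by
  rw [ker_eq_coe hρ]; exact SchwartzMap.memLp _ p volume

theorem integrable_mult (hρ : IsWindow ρ) (k : Fin n → ℤ) : Integrable (mult ρ k) := by
  rw [← coe_multSchwartz hρ]; exact SchwartzMap.integrable _

theorem fourier_ker (hρ : IsWindow ρ) (k : Fin n → ℤ) : 𝓕 (ker ρ k) = mult ρ k := by
  rw [ker_eq_coe hρ, ← SchwartzMap.fourier_coe, FourierTransform.fourier_fourierInv_eq,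
    coe_multSchwartz]

theorem mult_shift (ρ : Space n → ℝ) (k : Fin n → ℤ) (η : Space n) :
    mult ρ k (η + (2 * π)⁻¹ • latticePoint k) = mult ρ 0 η := by
  have := sigma_shift ρ 0 k ((2 * π) • η)
  rw [mult, mult, ← this, smul_add, smul_smul, mul_inv_cancel₀ Real.two_pi_pos.ne', one_smul,
    zero_add]

/-- Translation in frequency is modulation in space. All kernels thus share one modulus, which makes
every constant below uniform in k. -/
theorem ker_eq (ρ : Space n → ℝ) (k : Fin n → ℤ) (x : Space n) :
    ker ρ k x = 𝐞 ⟪(2 * π)⁻¹ • latticePoint k, x⟫ * ker ρ 0 x := by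
  rw [ker, ker, fourierInv_eq_mul, fourierInv_eq_mul,
    ← integral_add_right_eq_self _ ((2 * π)⁻¹ • latticePoint k), ← integral_const_mul]
  congr 1 with η
  rw [mult_shift, inner_add_left, fourierChar_add_coe]
  ring

theorem norm_ker (ρ : Space n → ℝ) (k : Fin n → ℤ) (x : Space n) :
    ‖ker ρ k x‖ = ‖ker ρ 0 x‖ := by
  rw [ker_eq, norm_mul, Circle.norm_coe, one_mul]

theorem eLpNorm_ker (ρ : Space n → ℝ) (k : Fin n → ℤ) (p : ℝ≥0∞) :
    eLpNorm (ker ρ k) p volume = eLpNorm (ker ρ 0) p volume :=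
  eLpNorm_congr_norm_ae (Filter.Eventually.of_forall (norm_ker ρ k))

theorem integral_sigma_zero_pos (hρ : IsWindow ρ) : 0 < ∫ η, sigma ρ 0 ((2 * π) • η) := by
  have hn : ∀ η : Space n, 0 ≤ sigma ρ 0 ((2 * π) • η) := fun η =>
    div_nonneg (hρ.nonneg _) (zero_le_one.trans (one_le_tsum_window hρ _))
  have hc : Continuous fun η : Space n => sigma ρ 0 ((2 * π) • η) := by
    have := Complex.continuous_re.comp (contDiff_mult hρ 0).continuous
    exact this.congr fun η => by simp [mult]
  refine hc.integral_pos_of_hasCompactSupport_nonneg_nonzero ?_ hn (x := 0) ?_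
  · refine (hasCompactSupport_mult hρ 0).mono fun η hη => ?_
    simpa [mult] using hη
  · rw [smul_zero, sigma, latticePoint_zero, sub_zero, hρ.eq_one 0 (by simp)]
    exact (div_pos one_pos (lt_of_lt_of_le one_pos (one_le_tsum_window hρ 0))).ne'

/-- The value at the origin is the integral of a nonnegative multiplier that does not vanish
identically. By continuity the kernel has no zeros near the origin, which the uniqueness argument
uses to cancel it. -/
theorem ker_zero_ne_zero (hρ : IsWindow ρ) : ker ρ 0 0 ≠ 0 := by
  rw [ker, fourierInv_eq_mul]
  simp only [inner_zero_right, AddChar.map_zero_eq_one, Circle.coe_one, one_mul, mult]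
  rw [integral_complex_ofReal]
  exact_mod_cast (integral_sigma_zero_pos hρ).ne'

theorem fourierInv_modulated_ker (hρ : IsWindow ρ) (j : Fin n → ℤ) (t ζ η : Space n) :
    𝓕⁻ (fun x => (𝐞 ⟪x, ζ⟫ : ℂ) * ker ρ j (t - x)) η
      = 𝐞 ⟪t, η + ζ⟫ * mult ρ j (η + ζ) := by
  rw [← fourier_ker hρ, fourierInv_eq_mul, fourier_eq_mul, ← integral_const_mul,
    ← integral_sub_left_eq_self _ _ t]
  congr 1 with x
  rw [sub_sub_cancel, ← mul_assoc, ← mul_assoc, ← fourierChar_add_coe, ← fourierChar_add_coe,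
    ← inner_add_right, inner_sub_left, sub_eq_add_neg]

theorem fourierInv_ker_sub (hρ : IsWindow ρ) (j : Fin n → ℤ) (t η : Space n) :
    𝓕⁻ (fun x => ker ρ j (t - x)) η = 𝐞 ⟪t, η⟫ * mult ρ j η := by
  simpa using fourierInv_modulated_ker hρ j t 0 η

theorem integrable_ker_sub (hρ : IsWindow ρ) (j : Fin n → ℤ) (t : Space n) :
    Integrable fun x => ker ρ j (t - x) := (integrable_ker hρ j).comp_sub_left t

theorem integral_mul_ker_sub (hρ : IsWindow ρ) (k : Fin n → ℤ) {θ : Space n → ℂ}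
    (hθ : Integrable θ) (y : Space n) :
    ∫ x, θ x * ker ρ k (x - y) = 𝓕 (fun η => mult ρ k η * 𝓕⁻ θ η) y :=
  integral_mul_fourierInv_sub hθ (integrable_mult hρ k) y

theorem integral_ker_mul_ker (hρ : IsWindow ρ) (j k : Fin n → ℤ) (t y : Space n) :
    ∫ x, ker ρ j (t - x) * ker ρ k (x - y)
      = 𝓕 (fun η => mult ρ k η * (𝐞 ⟪t, η⟫ * mult ρ j η)) y := by
  rw [integral_mul_ker_sub hρ k (integrable_ker_sub hρ j t)]
  simp_rw [fourierInv_ker_sub hρ]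

/-- The two multipliers live within distance one of j and k in each coordinate; if their product is
not identically zero, then k - j has coordinates at most two. -/
theorem integral_ker_mul_ker_eq_zero (hρ : IsWindow ρ) {j k : Fin n → ℤ}
    (h : k - j ∉ cube n 2) (t y : Space n) :
    ∫ x, ker ρ j (t - x) * ker ρ k (x - y) = 0 := by
  have h0 : (fun η => mult ρ k η * (𝐞 ⟪t, η⟫ * mult ρ j η)) = fun _ => 0 := by
    ext η
    by_contra hne
    simp only [mul_eq_zero, not_or] at hne
    refine h (mem_cube.2 fun i => ?_)
    have a := le_one_of_mult_ne_zero hρ hne.1 i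
    have b := le_one_of_mult_ne_zero hρ hne.2.2 i
    have : |((k i - j i : ℤ) : ℝ)| ≤ (2 : ℤ) := by
      push_cast; rw [abs_le] at a b ⊢; constructor <;> linarith [a.1, a.2, b.1, b.2]
    exact_mod_cast this
  rw [integral_ker_mul_ker hρ, h0, fourier_eq_mul]
  simp

/-- On the support of the j-th multiplier only the neighbours j + d contribute to the partition of
unity, so their sum is already one there. -/
theorem mult_mul_sum_mult (hρ : IsWindow ρ) (j : Fin n → ℤ) (η : Space n) :
    (∑ d ∈ cube n 2, mult ρ (j + d) η) * mult ρ j η = mult ρ j η := by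
  rcases eq_or_ne (mult ρ j η) 0 with h | h
  · simp [h]
  have h1 : ∑' d, mult ρ (j + d) η = 1 := by
    rw [← (hasSum_mult hρ η).tsum_eq]
    exact (Equiv.addLeft j).tsum_eq fun d => mult ρ d η
  rw [tsum_eq_sum (s := cube n 2)] at h1
  · rw [h1, one_mul]
  intro d hd
  by_contra hne
  refine hd (mem_cube.2 fun i => ?_)
  have a := le_one_of_mult_ne_zero hρ h i
  have b := le_one_of_mult_ne_zero hρ hne i
  have : |((d i : ℤ) : ℝ)| ≤ (2 : ℤ) := by
    simp only [Pi.add_apply] at b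
    push_cast at b ⊢; rw [abs_le] at a b ⊢; constructor <;> linarith [a.1, a.2, b.1, b.2]
  exact_mod_cast this

theorem sum_integral_ker_mul_ker (hρ : IsWindow ρ) (j : Fin n → ℤ) (t y : Space n) :
    ∑ d ∈ cube n 2, ∫ x, ker ρ j (t - x) * ker ρ (j + d) (x - y) = ker ρ j (t - y) := by
  simp_rw [integral_ker_mul_ker hρ, fourier_eq_mul]
  rw [← integral_finsetSum]
  · rw [ker, fourierInv_eq_mul]
    congr 1 with η
    have := mult_mul_sum_mult hρ j η
    rw [← Finset.mul_sum]
    simp_rw [mul_left_comm _ (𝐞 ⟪t, η⟫ : ℂ) _]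
    rw [← Finset.mul_sum, ← Finset.sum_mul, this, ← mul_assoc, ← fourierChar_add_coe,
      inner_sub_right, real_inner_comm t η]
    congr 3
    ring
  · intro d _
    refine integrable_fourierChar_mul ?_ (by fun_prop)
    refine Integrable.congr (f := fun η => (𝐞 ⟪t, η⟫ : ℂ) * (mult ρ (j + d) η * mult ρ j η)) ?_ ?_
    · refine integrable_fourierChar_mul ?_ (by fun_prop)
      refine Continuous.integrable_of_hasCompactSupport
        ((contDiff_mult hρ _).continuous.mul (contDiff_mult hρ _).continuous) ?_
      exact (hasCompactSupport_mult hρ j).mul_left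
    · exact Filter.Eventually.of_forall fun η => by ring

/-- Frequencies add under multiplication: a nonzero contribution needs η near l, ζ near m and η + ζ
near j, each up to one per coordinate, which gives the cube of radius three. -/
theorem integral_ker_mul_ker_mul_ker_eq_zero (hρ : IsWindow ρ) {j l m : Fin n → ℤ}
    (h : j - l - m ∉ cube n 3) (t a b : Space n) :
    ∫ x, ker ρ j (t - x) * ker ρ l (x - a) * ker ρ m (x - b) = 0 := by
  have hb : ∀ x, ‖ker ρ l (x - a)‖ ≤ ∫ η, ‖mult ρ l η‖ := fun x =>
    VectorFourier.norm_fourierIntegral_le_integral_norm _ _ _ _ _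
  have hint : Integrable fun x => ker ρ j (t - x) * ker ρ l (x - a) :=
    (integrable_ker_sub hρ j t).mul_bdd (c := ∫ η, ‖mult ρ l η‖)
      ((continuous_ker hρ l).comp (by fun_prop)).aestronglyMeasurable
      (Filter.Eventually.of_forall hb)
  have h0 : (fun η => mult ρ m η * 𝓕⁻ (fun x => ker ρ j (t - x) * ker ρ l (x - a)) η)
      = fun _ => 0 := by
    ext ζ
    rw [fourierInv_eq_mul]
    simp_rw [← mul_assoc]
    rw [integral_mul_ker_sub hρ l
      (integrable_fourierChar_mul (integrable_ker_sub hρ j t) (by fun_prop))]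
    simp_rw [fourierInv_modulated_ker hρ]
    rw [fourier_eq_mul, ← integral_const_mul]
    refine integral_eq_zero_of_ae (Filter.Eventually.of_forall fun η => ?_)
    by_contra hne
    simp only [Pi.zero_apply, mul_eq_zero, not_or] at hne
    refine h (mem_cube.2 fun i => ?_)
    have a1 := le_one_of_mult_ne_zero hρ hne.1 i
    have a2 := le_one_of_mult_ne_zero hρ hne.2.2.1 i
    have a3 := le_one_of_mult_ne_zero hρ hne.2.2.2.2 i
    have : |((j i - l i - m i : ℤ) : ℝ)| ≤ (3 : ℤ) := by
      simp only [PiLp.add_apply, mul_add] at a3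
      push_cast; rw [abs_le] at a1 a2 a3 ⊢
      constructor <;> linarith [a1.1, a1.2, a2.1, a2.2, a3.1, a3.2]
    exact_mod_cast this
  rw [integral_mul_ker_sub hρ m hint, h0, fourier_eq_mul]
  simp

end

end GevreyModulation

end

noncomputable section

namespace GevreyModulation

open FourierTransform
open scoped Real RealInnerProductSpace

/-! ### The operators `□_k` on `L^p` as convolutions -/

/-- The convolution with the kernel of `□_k`. -/
def bx {n : ℕ} (ρ : Space n → ℝ) (k : Fin n → ℤ) (f : Space n → ℂ) (x : Space n) : ℂ :=
  ∫ y, ker ρ k (x - y) * f y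

/-- The `L^{p'}` norm of the kernels. -/
def kerConj {n : ℕ} (ρ : Space n → ℝ) (p : ℝ≥0∞) : ℝ≥0∞ :=
  eLpNorm (ker ρ 0) (1 - p⁻¹)⁻¹ volume

/-- The `L^1` norm of the kernels. -/
def kerOne {n : ℕ} (ρ : Space n → ℝ) : ℝ≥0∞ := eLpNorm (ker ρ 0) 1 volume

section

variable {n : ℕ} {ρ : Space n → ℝ} {p : ℝ≥0∞} [hp : Fact (1 ≤ p)]

omit hp in
theorem kerConj_ne_top (hρ : IsWindow ρ) : kerConj ρ p ≠ ∞ := (memLp_ker hρ 0 _).eLpNorm_ne_top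

theorem kerOne_ne_top (hρ : IsWindow ρ) : kerOne ρ ≠ ∞ := (memLp_ker hρ 0 _).eLpNorm_ne_top

theorem lintegral_ker_mul_le (hρ : IsWindow ρ) (k : Fin n → ℤ) {f : Space n → ℂ}
    (hf : AEStronglyMeasurable f volume) (x : Space n) :
    ∫⁻ y, ‖ker ρ k (x - y) * f y‖ₑ ≤ kerConj ρ p * eLpNorm f p volume := by
  have := ENNReal.HolderConjugate.inv_one_sub_inv' hp.out
  have : ENNReal.HolderTriple (1 - p⁻¹)⁻¹ p 1 := ENNReal.HolderTriple.symm
  have hm : AEStronglyMeasurable (fun y => ker ρ k (x - y)) volume :=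
    ((continuous_ker hρ k).comp (by fun_prop)).aestronglyMeasurable
  have h := eLpNorm_smul_le_mul_eLpNorm (p := (1 - p⁻¹)⁻¹) (q := p) (r := 1) hf hm
  rw [eLpNorm_one_eq_lintegral_enorm] at h
  refine h.trans_eq ?_
  congr 1
  have h2 := eLpNorm_comp_measurePreserving (p := (1 - p⁻¹)⁻¹)
    (continuous_ker hρ k).aestronglyMeasurable
    (Measure.measurePreserving_sub_left (volume : Measure (Space n)) x)
  rw [kerConj, ← eLpNorm_ker ρ k, ← h2]
  rfl

theorem aestronglyMeasurable_ker_mul (hρ : IsWindow ρ) (k : Fin n → ℤ) {f : Space n → ℂ}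
    (hf : AEStronglyMeasurable f volume) (x : Space n) :
    AEStronglyMeasurable (fun y => ker ρ k (x - y) * f y) volume :=
  ((continuous_ker hρ k).comp (by fun_prop)).aestronglyMeasurable.mul hf

theorem integrable_ker_mul (hρ : IsWindow ρ) (k : Fin n → ℤ) {f : Space n → ℂ}
    (hf : MemLp f p volume) (x : Space n) : Integrable fun y => ker ρ k (x - y) * f y := by
  refine ⟨aestronglyMeasurable_ker_mul hρ k hf.1 x, ?_⟩
  exact (lintegral_ker_mul_le hρ k hf.1 x).trans_lt
    (ENNReal.mul_lt_top (kerConj_ne_top hρ).lt_top hf.2)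

theorem enorm_bx_le (hρ : IsWindow ρ) (k : Fin n → ℤ) {f : Space n → ℂ}
    (hf : AEStronglyMeasurable f volume) (x : Space n) :
    ‖bx ρ k f x‖ₑ ≤ kerConj ρ p * eLpNorm f p volume :=
  (enorm_integral_le_lintegral_enorm _).trans (lintegral_ker_mul_le hρ k hf x)

theorem aestronglyMeasurable_bx (hρ : IsWindow ρ) (k : Fin n → ℤ) {f : Space n → ℂ}
    (hf : AEStronglyMeasurable f volume) : AEStronglyMeasurable (bx ρ k f) volume := by
  have : AEStronglyMeasurable (fun z : Space n × Space n => ker ρ k (z.1 - z.2) * f z.2)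
      (volume.prod volume) :=
    ((continuous_ker hρ k).comp (by fun_prop)).aestronglyMeasurable.mul hf.comp_snd
  exact this.integral_prod_right'

theorem eLpNorm_bx_le (hρ : IsWindow ρ) (k : Fin n → ℤ) {f : Space n → ℂ}
    (hf : AEStronglyMeasurable f volume) (hp1 : p ≠ ∞) :
    eLpNorm (bx ρ k f) p volume ≤ kerOne ρ * eLpNorm f p volume := by
  have h := eLpNorm_lconvolution_le (c := fun x => ‖ker ρ k x‖ₑ) (f := fun x => ‖f x‖ₑ)
    (continuous_ker hρ k).measurable.enorm hf.enorm hp.out hp1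
  rw [eLpNorm_enorm, ← eLpNorm_one_eq_lintegral_enorm, eLpNorm_ker] at h
  refine (eLpNorm_mono_enorm fun x => ?_).trans h
  rw [enorm_eq_self]
  refine (enorm_integral_le_lintegral_enorm _).trans_eq ?_
  simp_rw [enorm_mul]

theorem memLp_bx (hρ : IsWindow ρ) (k : Fin n → ℤ) {f : Space n → ℂ}
    (hf : MemLp f p volume) (hp1 : p ≠ ∞) : MemLp (bx ρ k f) p volume :=
  ⟨aestronglyMeasurable_bx hρ k hf.1, (eLpNorm_bx_le hρ k hf.1 hp1).trans_lt
    (ENNReal.mul_lt_top (kerOne_ne_top hρ).lt_top hf.2)⟩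

theorem integrable_prod_mul_bx (hρ : IsWindow ρ) (k : Fin n → ℤ) {θ f : Space n → ℂ}
    (hθ : Integrable θ) (hf : MemLp f p volume) :
    Integrable (Function.uncurry fun y a : Space n => θ y * (ker ρ k (y - a) * f a))
      (volume.prod volume) := by
  have hm : AEStronglyMeasurable
      (Function.uncurry fun y a : Space n => θ y * (ker ρ k (y - a) * f a))
      (volume.prod volume) :=
    hθ.1.comp_fst.mul
      (((continuous_ker hρ k).comp (by fun_prop)).aestronglyMeasurable.mul hf.1.comp_snd)
  refine ⟨hm, ?_⟩
  rw [HasFiniteIntegral, lintegral_prod _ hm.enorm]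
  simp only [Function.uncurry_apply_pair, enorm_mul]
  calc ∫⁻ y, ∫⁻ a, ‖θ y‖ₑ * (‖ker ρ k (y - a)‖ₑ * ‖f a‖ₑ)
      ≤ ∫⁻ y, ‖θ y‖ₑ * (kerConj ρ p * eLpNorm f p volume) := by
        refine lintegral_mono fun y => ?_
        dsimp only
        rw [lintegral_const_mul' _ _ enorm_ne_top]
        gcongr
        simpa only [enorm_mul] using lintegral_ker_mul_le hρ k hf.1 y
    _ < ∞ := by
        rw [lintegral_mul_const' _ _
          (ENNReal.mul_ne_top (kerConj_ne_top hρ) hf.eLpNorm_ne_top)]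
        exact ENNReal.mul_lt_top hθ.2
          (ENNReal.mul_lt_top (kerConj_ne_top hρ).lt_top hf.2)

theorem integrable_mul_integral_ker (hρ : IsWindow ρ) (k : Fin n → ℤ) {θ f : Space n → ℂ}
    (hθ : Integrable θ) (hf : MemLp f p volume) :
    Integrable fun a => f a * ∫ y, θ y * ker ρ k (y - a) := by
  refine (integrable_prod_mul_bx hρ k hθ hf).integral_prod_right.congr
    (Filter.Eventually.of_forall fun a => ?_)
  simp only [Function.uncurry_apply_pair]
  rw [← integral_const_mul]
  exact integral_congr_ae (Filter.Eventually.of_forall fun y => by ring)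

/-- Fubini moves □_k to the integrable test function. Through this identity, statements on □_k f for
f in L^p reduce to identities between kernels. -/
theorem integral_mul_bx (hρ : IsWindow ρ) (k : Fin n → ℤ) {θ f : Space n → ℂ}
    (hθ : Integrable θ) (hf : MemLp f p volume) :
    ∫ y, θ y * bx ρ k f y = ∫ a, f a * ∫ y, θ y * ker ρ k (y - a) := by
  simp_rw [bx, ← integral_const_mul]
  rw [integral_integral_swap (integrable_prod_mul_bx hρ k hθ hf)]
  congr 1 with a
  congr 1 with y
  ring

theorem bx_sub (hρ : IsWindow ρ) (k : Fin n → ℤ) {f g : Space n → ℂ} (hf : MemLp f p volume)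
    (hg : MemLp g p volume) (x : Space n) :
    bx ρ k (fun y => f y - g y) x = bx ρ k f x - bx ρ k g x := by
  simp_rw [bx, mul_sub]
  exact integral_sub (integrable_ker_mul hρ k hf x) (integrable_ker_mul hρ k hg x)

theorem bx_finsetSum (hρ : IsWindow ρ) (k : Fin n → ℤ) {ι : Type*} (s : Finset ι)
    {f : ι → Space n → ℂ} (hf : ∀ i ∈ s, MemLp (f i) p volume) (x : Space n) :
    bx ρ k (fun y => ∑ i ∈ s, f i y) x = ∑ i ∈ s, bx ρ k (f i) x := by
  simp_rw [bx, Finset.mul_sum]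
  exact integral_finsetSum s fun i hi => integrable_ker_mul hρ k (hf i hi) x

theorem bx_bx (hρ : IsWindow ρ) (j k : Fin n → ℤ) {f : Space n → ℂ} (hf : MemLp f p volume)
    (x : Space n) :
    bx ρ j (bx ρ k f) x = ∫ a, f a * ∫ y, ker ρ j (x - y) * ker ρ k (y - a) :=
  integral_mul_bx hρ k (integrable_ker_sub hρ j x) hf

theorem bx_bx_comm (hρ : IsWindow ρ) (j k : Fin n → ℤ) {f : Space n → ℂ}
    (hf : MemLp f p volume) (x : Space n) :
    bx ρ j (bx ρ k f) x = bx ρ k (bx ρ j f) x := by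
  rw [bx_bx hρ j k hf, bx_bx hρ k j hf]
  simp_rw [integral_ker_mul_ker hρ]
  congr 1 with a
  congr 1
  exact congrArg (fun F : Space n → ℂ => 𝓕 F a) (funext fun η => by ring)

theorem bx_bx_eq_zero (hρ : IsWindow ρ) {j k : Fin n → ℤ} (h : k - j ∉ cube n 2)
    {f : Space n → ℂ} (hf : MemLp f p volume) (x : Space n) : bx ρ j (bx ρ k f) x = 0 := by
  rw [bx_bx hρ j k hf]
  simp [integral_ker_mul_ker_eq_zero hρ h]

theorem sum_bx_bx (hρ : IsWindow ρ) (j : Fin n → ℤ) {f : Space n → ℂ} (hf : MemLp f p volume)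
    (x : Space n) :
    ∑ d ∈ cube n 2, bx ρ j (bx ρ (j + d) f) x = bx ρ j f x := by
  simp_rw [fun d => bx_bx hρ j (j + d) hf x]
  rw [← integral_finsetSum _ fun d _ =>
    integrable_mul_integral_ker hρ (j + d) (integrable_ker_sub hρ j x) hf]
  simp_rw [← Finset.mul_sum, sum_integral_ker_mul_ker hρ, bx, mul_comm]

/-- The constant of the inequality between the `L^∞` and `L^p` norms of `□_k f`. -/
def nikConst (ρ : Space n → ℝ) (p : ℝ≥0∞) : ℝ≥0∞ := (cube n 2).card * kerConj ρ p

omit hp in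
theorem nikConst_ne_top (hρ : IsWindow ρ) : nikConst ρ p ≠ ∞ :=
  ENNReal.mul_ne_top (ENNReal.natCast_ne_top _) (kerConj_ne_top hρ)

/-- Bernstein–Nikolskii inequality: □_k f is reproduced by finitely many neighbours, □_k f = ∑_d
□_{k+d} □_k f, and Hölder is applied to the outer convolution. -/
theorem enorm_bx_le_eLpNorm_bx (hρ : IsWindow ρ) (k : Fin n → ℤ) {f : Space n → ℂ}
    (hf : MemLp f p volume) (x : Space n) :
    ‖bx ρ k f x‖ₑ ≤ nikConst ρ p * eLpNorm (bx ρ k f) p volume := by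
  rw [← sum_bx_bx hρ k hf]
  calc ‖∑ d ∈ cube n 2, bx ρ k (bx ρ (k + d) f) x‖ₑ
      ≤ ∑ d ∈ cube n 2, ‖bx ρ k (bx ρ (k + d) f) x‖ₑ := enorm_sum_le _ _
    _ ≤ ∑ d ∈ cube n 2, kerConj ρ p * eLpNorm (bx ρ k f) p volume := by
        refine Finset.sum_le_sum fun d _ => ?_
        rw [bx_bx_comm hρ k (k + d) hf]
        exact enorm_bx_le hρ _ (aestronglyMeasurable_bx hρ k hf.1) x
    _ = _ := by rw [Finset.sum_const, nsmul_eq_mul, nikConst, mul_assoc]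

theorem integrable_ker_mul_bx (hρ : IsWindow ρ) (j k : Fin n → ℤ) {f : Space n → ℂ}
    (hf : MemLp f p volume) (x : Space n) :
    Integrable fun y => ker ρ j (x - y) * bx ρ k f y := by
  refine (integrable_ker_sub hρ j x).mul_bdd
    (c := (kerConj ρ p * eLpNorm f p volume).toReal) (aestronglyMeasurable_bx hρ k hf.1)
    (Filter.Eventually.of_forall fun y => ?_)
  rw [← toReal_enorm]
  exact ENNReal.toReal_mono (ENNReal.mul_ne_top (kerConj_ne_top hρ) hf.eLpNorm_ne_top)
    (enorm_bx_le hρ k hf.1 y)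

/-- The pieces need not be integrable, so Fubini removes one factor at a time: the outer kernel
times a bounded function serves as the integrable test function. What remains is the integral of
three kernels. -/
theorem bx_mul_bx_eq_zero (hρ : IsWindow ρ) {j l m : Fin n → ℤ} (h : j - l - m ∉ cube n 3)
    {f g : Space n → ℂ} (hf : MemLp f p volume) (hg : MemLp g p volume) (x : Space n) :
    bx ρ j (fun y => bx ρ l f y * bx ρ m g y) x = 0 := by
  have h1 : ∀ a, Integrable fun y => ker ρ j (x - y) * ker ρ l (y - a) := fun a => by
    refine (integrable_ker_sub hρ j x).mul_bdd (c := ∫ η, ‖mult ρ l η‖)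
      ((continuous_ker hρ l).comp (by fun_prop)).aestronglyMeasurable
      (Filter.Eventually.of_forall fun y =>
        VectorFourier.norm_fourierIntegral_le_integral_norm _ _ _ _ _)
  have h2 : bx ρ j (fun y => bx ρ l f y * bx ρ m g y) x
      = ∫ y, (ker ρ j (x - y) * bx ρ m g y) * bx ρ l f y := by
    rw [bx]; congr 1 with y; ring
  have h3 : ∀ a, ∫ y, ker ρ j (x - y) * bx ρ m g y * ker ρ l (y - a) = 0 := fun a => by
    have : ∫ y, ker ρ j (x - y) * bx ρ m g y * ker ρ l (y - a)
        = ∫ y, (ker ρ j (x - y) * ker ρ l (y - a)) * bx ρ m g y := by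
      congr 1 with y; ring
    rw [this, integral_mul_bx hρ m (h1 a) hg]
    simp [integral_ker_mul_ker_mul_ker_eq_zero hρ h]
  rw [h2, integral_mul_bx hρ l (integrable_ker_mul_bx hρ j m hg x) hf]
  simp [h3]

/-! ### Identification with the operators on tempered distributions -/

theorem toTemperedDistribution_bx (hρ : IsWindow ρ) (k : Fin n → ℤ) {f : Space n → ℂ}
    (hf : MemLp f p volume) (hp1 : p ≠ ∞) :
    Lp.toTemperedDistribution ((memLp_bx hρ k hf hp1).toLp (bx ρ k f))
      = box ρ k (Lp.toTemperedDistribution (hf.toLp f)) := by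
  ext u
  rw [box, TemperedDistribution.fourierMultiplierCLM_apply_apply,
    Lp.toTemperedDistribution_apply, Lp.toTemperedDistribution_apply]
  have e1 : ∫ x, u x • ((memLp_bx hρ k hf hp1).toLp (bx ρ k f)) x
      = ∫ x, u x * bx ρ k f x := by
    refine integral_congr_ae ?_
    filter_upwards [(memLp_bx hρ k hf hp1).coeFn_toLp] with x hx
    rw [hx, smul_eq_mul]
  rw [e1, integral_mul_bx hρ k u.integrable hf]
  refine integral_congr_ae ?_
  filter_upwards [hf.coeFn_toLp] with y hy
  rw [hy, smul_eq_mul, mul_comm, integral_mul_ker_sub hρ k u.integrable, SchwartzMap.fourier_coe]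
  congr 1
  refine congrArg (fun F : Space n → ℂ => 𝓕 F y) (funext fun η => ?_)
  rw [SchwartzMap.smulLeftCLM_apply_apply (hasTemperateGrowth_multiplier hρ k),
    SchwartzMap.fourierInv_coe]
  rfl

theorem lpENorm_toTemperedDistribution (g : Lp ℂ p (volume : Measure (Space n))) :
    lpENorm p (Lp.toTemperedDistribution g) = ‖g‖ₑ := by
  unfold lpENorm
  refine le_antisymm (iInf_le_of_le g (iInf_le_of_le rfl le_rfl)) (le_iInf₂ fun g' hg' => ?_)
  have hinj := LinearMap.ker_eq_bot.1
    (Lp.ker_toTemperedDistributionCLM_eq_bot (F := ℂ) (μ := (volume : Measure (Space n))) (p := p))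
  rw [hinj hg']

theorem lpENorm_box (hρ : IsWindow ρ) (k : Fin n → ℤ) {f : Space n → ℂ}
    (hf : MemLp f p volume) (hp1 : p ≠ ∞) :
    lpENorm p (box ρ k (Lp.toTemperedDistribution (hf.toLp f)))
      = eLpNorm (bx ρ k f) p volume := by
  rw [← toTemperedDistribution_bx hρ k hf hp1, lpENorm_toTemperedDistribution, Lp.enorm_toLp]

/-! ### A function in `L^p` is determined by its frequency-uniform pieces -/

theorem ae_eq_zero_of_fourier_eq_zero {g : Space n → ℂ} (hg : Integrable g)
    (h : ∀ ξ, 𝓕 g ξ = 0) : g =ᵐ[volume] 0 := by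
  refine ae_eq_zero_of_integral_contDiff_smul_eq_zero hg.locallyIntegrable fun ψ hψ hc => ?_
  have hc1 : HasCompactSupport (Complex.ofRealCLM ∘ ψ) := hc.comp_left rfl
  set S : 𝓢(Space n, ℂ) := hc1.toSchwartzMap (Complex.ofRealCLM.contDiff.comp hψ)
  have h1 := integral_fourier_mul_eq hg (𝓕⁻ S : 𝓢(Space n, ℂ)).integrable
  rw [← SchwartzMap.fourier_coe, FourierTransform.fourier_fourierInv_eq] at h1
  simp only [h, zero_mul, integral_zero] at h1
  rw [h1]
  congr 1 with x
  simp [S, mul_comm]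

theorem exists_sum_mult_mul_mult (hρ : IsWindow ρ) (ξ : Space n) : ∃ J : Finset (Fin n → ℤ),
    ∀ η, (∑ j ∈ J, mult ρ j η) * mult ρ 0 (η - ξ) = mult ρ 0 (η - ξ) := by
  refine ⟨Finset.Icc (fun i => ⌊2 * π * ξ i⌋ - 3) (fun i => ⌊2 * π * ξ i⌋ + 3), fun η => ?_⟩
  rcases eq_or_ne (mult ρ 0 (η - ξ)) 0 with h | h
  · simp [h]
  have h1 := (hasSum_mult hρ η).tsum_eq
  rw [tsum_eq_sum] at h1
  · rw [h1, one_mul]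
  intro j hj
  by_contra hne
  refine hj (Finset.mem_Icc.2 ?_)
  have key : ∀ i, ⌊2 * π * ξ i⌋ - 3 ≤ j i ∧ j i ≤ ⌊2 * π * ξ i⌋ + 3 := fun i => by
    have a := le_one_of_mult_ne_zero hρ h i
    have b := le_one_of_mult_ne_zero hρ hne i
    have f1 := Int.floor_le (2 * π * ξ i)
    have f2 := Int.lt_floor_add_one (2 * π * ξ i)
    simp only [PiLp.sub_apply, mul_sub, Pi.zero_apply, Int.cast_zero, sub_zero] at a
    rw [abs_le] at a b
    constructor
    · have : ((⌊2 * π * ξ i⌋ - 3 : ℤ) : ℝ) ≤ (j i : ℝ) := by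
        push_cast; linarith [a.1, a.2, b.1, b.2]
      exact_mod_cast this
    · have : (j i : ℝ) ≤ ((⌊2 * π * ξ i⌋ + 3 : ℤ) : ℝ) := by
        push_cast; linarith [a.1, a.2, b.1, b.2]
      exact_mod_cast this
  exact ⟨fun i => (key i).1, fun i => (key i).2⟩

/-- The modulated kernel has a compactly supported inverse Fourier transform, so finitely many
multipliers reproduce it. Transposing them to h produces the functions □_j h, which vanish. -/
theorem integral_modulated_ker_mul_eq_zero (hρ : IsWindow ρ) {h : Space n → ℂ}
    (hh : MemLp h p volume) (h0 : ∀ j x, bx ρ j h x = 0) (z ξ : Space n) :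
    ∫ y, h y * ((𝐞 ⟪y, -ξ⟫ : ℂ) * ker ρ 0 (z - y)) = 0 := by
  set q : Space n → ℂ := fun y => (𝐞 ⟪y, -ξ⟫ : ℂ) * ker ρ 0 (z - y) with hq
  have hqi : Integrable q := integrable_fourierChar_mul (integrable_ker_sub hρ 0 z) (by fun_prop)
  have hqF : 𝓕⁻ q = fun η => (𝐞 ⟪z, η - ξ⟫ : ℂ) * mult ρ 0 (η - ξ) := by
    ext η
    rw [hq, fourierInv_modulated_ker hρ, sub_eq_add_neg]
  have hqFi : Integrable (𝓕⁻ q) := by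
    rw [hqF]
    exact integrable_fourierChar_mul ((integrable_mult hρ 0).comp_sub_right ξ) (by fun_prop)
  have hqFi' : Integrable (𝓕 q) := hqFi.comp_neg.congr
    (Filter.Eventually.of_forall fun η => by simp [Real.fourierInv_eq_fourier_neg])
  have hqc : Continuous q := (continuous_fourierChar_coe (by fun_prop)).mul
    ((continuous_ker hρ 0).comp (by fun_prop))
  obtain ⟨J, hJ⟩ := exists_sum_mult_mul_mult hρ ξ
  have hrep : ∀ y, q y = ∑ j ∈ J, ∫ x, q x * ker ρ j (x - y) := fun y => by
    simp_rw [fun j => integral_mul_ker_sub hρ j hqi y, fourier_eq_mul]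
    rw [← integral_finsetSum]
    · simp_rw [← Finset.mul_sum, ← Finset.sum_mul]
      rw [← hqi.fourier_fourierInv_eq hqFi' hqc.continuousAt, fourier_eq_mul]
      congr 1 with η
      rw [hqF]
      simp only
      rw [mul_left_comm (∑ j ∈ J, mult ρ j η), hJ]
    · intro j _
      refine integrable_fourierChar_mul ?_ (by fun_prop)
      refine hqFi.bdd_mul (c := 1) (contDiff_mult hρ j).continuous.aestronglyMeasurable
        (Filter.Eventually.of_forall fun η => ?_)
      have h1 := one_le_tsum_window hρ ((2 * π) • η)
      have h2 := (summable_window hρ ((2 * π) • η)).le_tsum j fun l _ => hρ.nonneg _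
      rw [mult, Complex.norm_real, Real.norm_eq_abs, sigma,
        abs_of_nonneg (div_nonneg (hρ.nonneg _) (zero_le_one.trans h1))]
      exact div_le_one_of_le₀ h2 (zero_le_one.trans h1)
  calc ∫ y, h y * q y = ∫ y, ∑ j ∈ J, h y * ∫ x, q x * ker ρ j (x - y) := by
        congr 1 with y
        conv_lhs => rw [hrep y]
        rw [Finset.mul_sum]
    _ = ∑ j ∈ J, ∫ x, q x * bx ρ j h x := by
        rw [integral_finsetSum _ fun j _ => integrable_mul_integral_ker hρ j hqi hh]
        simp_rw [fun j => integral_mul_bx hρ j hqi hh]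
    _ = 0 := by simp [h0]

/-- Multiplication by a translated kernel makes h integrable, and by the preceding lemma the product
has zero Fourier transform. The kernel is nonzero near the origin, and a dense sequence of
translations has a member close to any given point, so only countably many null sets occur. -/
theorem ae_eq_zero_of_bx_eq_zero (hρ : IsWindow ρ) {h : Space n → ℂ} (hh : MemLp h p volume)
    (h0 : ∀ j x, bx ρ j h x = 0) : h =ᵐ[volume] 0 := by
  have key : ∀ z, ∀ᵐ y, ker ρ 0 (z - y) * h y = 0 := fun z => by
    refine ae_eq_zero_of_fourier_eq_zero (integrable_ker_mul hρ 0 hh z) fun ξ => ?_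
    rw [fourier_eq_mul, ← integral_modulated_ker_mul_eq_zero hρ hh h0 z ξ]
    congr 1 with y
    rw [inner_neg_right]
    ring
  obtain ⟨r, hr, hr0⟩ := Metric.eventually_nhds_iff.1
    ((continuous_ker hρ 0).continuousAt.eventually_ne (ker_zero_ne_zero hρ))
  filter_upwards [ae_all_iff.2 fun i => key (TopologicalSpace.denseSeq (Space n) i)] with y hy
  obtain ⟨i, hi⟩ := (TopologicalSpace.denseRange_denseSeq (Space n)).exists_dist_lt y hr
  refine (mul_eq_zero.1 (hy i)).resolve_left (hr0 ?_)
  rwa [dist_zero_right, ← dist_eq_norm, dist_comm]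

end

end GevreyModulation

end

noncomputable section

namespace GevreyModulation

/-! ### Countable superpositions -/

/-- The norm `‖□_k f‖_{L^p}`. -/
def bxNorm {n : ℕ} (ρ : Space n → ℝ) (p : ℝ≥0∞) (f : Space n → ℂ) (k : Fin n → ℤ) : ℝ≥0∞ :=
  eLpNorm (bx ρ k f) p volume

/-- The norm of `W(k) ‖□_k f‖_{L^p}` in `ℓ^q` for a weight `W` on `ℤⁿ`. -/
def wNorm {n : ℕ} (ρ : Space n → ℝ) (p q : ℝ≥0∞) (W : (Fin n → ℤ) → ℝ≥0∞)
    (f : Space n → ℂ) : ℝ≥0∞ :=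
  lq q fun k => W k * bxNorm ρ p f k

section

variable {n : ℕ} {ρ : Space n → ℝ} {p : ℝ≥0∞} [hp : Fact (1 ≤ p)]

theorem bxNorm_le (hρ : IsWindow ρ) (hp1 : p ≠ ∞) {f : Space n → ℂ}
    (hf : AEStronglyMeasurable f volume) (k : Fin n → ℤ) :
    bxNorm ρ p f k ≤ kerOne ρ * eLpNorm f p volume := eLpNorm_bx_le hρ k hf hp1

theorem hasSum_bx (hρ : IsWindow ρ) {ι : Type*} [Countable ι] {f : ι → Space n → ℂ}
    {F : Space n → ℂ} (hf : ∀ i, MemLp (f i) p volume)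
    (hs : ∑' i, eLpNorm (f i) p volume ≠ ∞) (hF : ∀ᵐ x, HasSum (fun i => f i x) (F x))
    (k : Fin n → ℤ) (x : Space n) : HasSum (fun i => bx ρ k (f i) x) (bx ρ k F x) := by
  have h1 : ∑' i, ∫⁻ y, ‖ker ρ k (x - y) * f i y‖ₑ ≠ ∞ := by
    refine ne_top_of_le_ne_top (ENNReal.mul_ne_top (kerConj_ne_top (p := p) hρ) hs) ?_
    rw [← ENNReal.tsum_mul_left]
    exact ENNReal.tsum_le_tsum fun i => lintegral_ker_mul_le hρ k (hf i).1 x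
  have h2 := hasSum_integral_of_summable_integral_norm
    (F := fun i y => ker ρ k (x - y) * f i y) (fun i => integrable_ker_mul hρ k (hf i) x) (by
      refine (ENNReal.summable_toReal h1).congr fun i => ?_
      rw [integral_norm_eq_lintegral_enorm (aestronglyMeasurable_ker_mul hρ k (hf i).1 x)])
  have h3 : bx ρ k F x = ∫ y, ∑' i, ker ρ k (x - y) * f i y := by
    refine integral_congr_ae ?_
    filter_upwards [hF] with y hy
    exact (hy.mul_left (ker ρ k (x - y))).tsum_eq.symm
  rw [h3]
  exact h2

theorem memLp_of_hasSum {ι : Type*} [Countable ι] {f : ι → Space n → ℂ}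
    {F : Space n → ℂ} (hf : ∀ i, MemLp (f i) p volume)
    (hs : ∑' i, eLpNorm (f i) p volume ≠ ∞) (hF : ∀ᵐ x, HasSum (fun i => f i x) (F x)) :
    MemLp F p volume := by
  refine ⟨?_, (eLpNorm_le_tsum_of_hasSum (fun i => (hf i).1) hp.out hF).trans_lt hs.lt_top⟩
  refine aestronglyMeasurable_of_tendsto_ae Filter.atTop
    (f := fun (s : Finset ι) x => ∑ i ∈ s, f i x)
    (fun s => Finset.aestronglyMeasurable_fun_sum s fun i _ => (hf i).1) ?_
  filter_upwards [hF] with x hx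
  simpa [HasSum] using hx

theorem bxNorm_le_tsum (hρ : IsWindow ρ) {ι : Type*} [Countable ι] {f : ι → Space n → ℂ}
    {F : Space n → ℂ} (hf : ∀ i, MemLp (f i) p volume)
    (hs : ∑' i, eLpNorm (f i) p volume ≠ ∞) (hF : ∀ᵐ x, HasSum (fun i => f i x) (F x))
    (k : Fin n → ℤ) : bxNorm ρ p F k ≤ ∑' i, bxNorm ρ p (f i) k :=
  eLpNorm_le_tsum_of_hasSum (fun i => aestronglyMeasurable_bx hρ k (hf i).1) hp.out
    (Filter.Eventually.of_forall fun x => hasSum_bx hρ hf hs hF k x)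

theorem bx_const_mul (ρ : Space n → ℝ) (k : Fin n → ℤ) (c : ℂ) (f : Space n → ℂ) (x : Space n) :
    bx ρ k (fun y => c * f y) x = c * bx ρ k f x := by
  simp_rw [bx, mul_left_comm _ c]
  exact integral_const_mul _ _

omit hp in
theorem bxNorm_const_mul (ρ : Space n → ℝ) (k : Fin n → ℤ) (c : ℂ) (f : Space n → ℂ) :
    bxNorm ρ p (fun y => c * f y) k = ‖c‖ₑ * bxNorm ρ p f k := by
  have : bx ρ k (fun y => c * f y) = c • bx ρ k f := by
    ext x; exact bx_const_mul ρ k c f x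
  rw [bxNorm, this, eLpNorm_const_smul, bxNorm]

/-! ### The frequency-uniform expansion -/

theorem summable_norm_bx (hρ : IsWindow ρ) {f : Space n → ℂ} (hf : MemLp f p volume)
    (hs : ∑' k, bxNorm ρ p f k ≠ ∞) (x : Space n) : Summable fun k => ‖bx ρ k f x‖ := by
  have h : ∑' k, ‖bx ρ k f x‖ₑ ≠ ∞ := by
    refine ne_top_of_le_ne_top (ENNReal.mul_ne_top (nikConst_ne_top (p := p) hρ) hs) ?_
    rw [← ENNReal.tsum_mul_left]
    exact ENNReal.tsum_le_tsum fun k => enorm_bx_le_eLpNorm_bx hρ k hf x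
  simpa using ENNReal.summable_toReal h

/-- The pieces sum absolutely to some g in L^p. Applying □_j termwise shows that f and g have the
same pieces, so uniqueness gives f = g almost everywhere. -/
theorem ae_hasSum_bx (hρ : IsWindow ρ) (hp1 : p ≠ ∞) {f : Space n → ℂ} (hf : MemLp f p volume)
    (hs : ∑' k, bxNorm ρ p f k ≠ ∞) : ∀ᵐ x, HasSum (fun k => bx ρ k f x) (f x) := by
  set g : Space n → ℂ := fun x => ∑' k, bx ρ k f x with hg
  have hgs : ∀ x, HasSum (fun k => bx ρ k f x) (g x) := fun x =>
    (summable_norm_bx hρ hf hs x).of_norm.hasSum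
  have hm : ∀ k, MemLp (bx ρ k f) p volume := fun k => memLp_bx hρ k hf hp1
  have hgm : MemLp g p volume := memLp_of_hasSum hm hs (Filter.Eventually.of_forall hgs)
  have hj : ∀ j x, bx ρ j (fun y => f y - g y) x = 0 := fun j x => by
    rw [bx_sub hρ j hf hgm, sub_eq_zero,
      ← (hasSum_bx hρ hm hs (Filter.Eventually.of_forall hgs) j x).tsum_eq,
      ← (Equiv.addLeft j).tsum_eq fun k => bx ρ j (bx ρ k f) x, ← sum_bx_bx hρ j hf]
    refine (tsum_eq_sum fun d hd => ?_).symm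
    exact bx_bx_eq_zero hρ (by simpa using hd) hf x
  filter_upwards [ae_eq_zero_of_bx_eq_zero hρ (hf.sub hgm) hj] with x hx
  rw [sub_eq_zero.1 hx]
  exact hgs x

theorem eLpNorm_le_tsum_bxNorm (hρ : IsWindow ρ) (hp1 : p ≠ ∞) {f : Space n → ℂ}
    (hf : MemLp f p volume) (hs : ∑' k, bxNorm ρ p f k ≠ ∞) :
    eLpNorm f p volume ≤ ∑' k, bxNorm ρ p f k :=
  eLpNorm_le_tsum_of_hasSum (fun k => aestronglyMeasurable_bx hρ k hf.1) hp.out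
    (ae_hasSum_bx hρ hp1 hf hs)

theorem ae_enorm_le_tsum_bxNorm (hρ : IsWindow ρ) (hp1 : p ≠ ∞) {f : Space n → ℂ}
    (hf : MemLp f p volume) (hs : ∑' k, bxNorm ρ p f k ≠ ∞) :
    ∀ᵐ x, ‖f x‖ₑ ≤ nikConst ρ p * ∑' k, bxNorm ρ p f k := by
  filter_upwards [ae_hasSum_bx hρ hp1 hf hs] with x hx
  rw [← hx.tsum_eq, ← ENNReal.tsum_mul_left]
  exact enorm_tsum_le_tsum_enorm.trans
    (ENNReal.tsum_le_tsum fun k => enorm_bx_le_eLpNorm_bx hρ k hf x)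

/-! ### Products -/

theorem eLpNorm_bx_mul_bx_le (hρ : IsWindow ρ) {f g : Space n → ℂ} (hf : MemLp f p volume)
    (hg : MemLp g p volume) (l m : Fin n → ℤ) :
    eLpNorm (fun x => bx ρ l f x * bx ρ m g x) p volume
      ≤ nikConst ρ p * bxNorm ρ p f l * bxNorm ρ p g m := by
  refine eLpNorm_le_mul_eLpNorm_of_ae_le_mul'' p (aestronglyMeasurable_bx hρ m hg.1)
    (Filter.Eventually.of_forall fun x => ?_)
  rw [enorm_mul]
  gcongr
  exact enorm_bx_le_eLpNorm_bx hρ l hf x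

theorem bxNorm_bx_mul_bx_le (hρ : IsWindow ρ) (hp1 : p ≠ ∞) {f g : Space n → ℂ}
    (hf : MemLp f p volume) (hg : MemLp g p volume) (k l m : Fin n → ℤ) :
    bxNorm ρ p (fun x => bx ρ l f x * bx ρ m g x) k ≤ if k - l - m ∈ cube n 3 then
      kerOne ρ * nikConst ρ p * (bxNorm ρ p f l * bxNorm ρ p g m) else 0 := by
  split_ifs with h
  · refine (bxNorm_le hρ hp1
      ((aestronglyMeasurable_bx hρ l hf.1).mul (aestronglyMeasurable_bx hρ m hg.1)) k).trans ?_
    rw [mul_assoc, ← mul_assoc (nikConst ρ p)]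
    gcongr
    exact eLpNorm_bx_mul_bx_le hρ hf hg l m
  · have : bx ρ k (fun x => bx ρ l f x * bx ρ m g x) = 0 := by
      ext x; exact bx_mul_bx_eq_zero hρ h hf hg x
    rw [bxNorm, this, eLpNorm_zero]

theorem tsum_ite_sub_mem_cube {r : ℕ} (j : Fin n → ℤ) (φ : (Fin n → ℤ) → ℝ≥0∞) :
    ∑' m, (if j - m ∈ cube n r then φ m else 0) = ∑ d ∈ cube n r, φ (j - d) := by
  rw [← (Equiv.subLeft j).tsum_eq]
  simp only [Equiv.subLeft_apply, sub_sub_cancel]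
  rw [tsum_eq_sum (s := cube n r) fun d hd => by simp [hd]]
  exact Finset.sum_congr rfl fun d hd => by simp [hd]

omit hp in
theorem hasSum_mul_prod {ι κ : Type*} {a : ι → ℂ} {b : κ → ℂ} {A B : ℂ} (ha : HasSum a A)
    (hb : HasSum b B) (ha' : Summable fun i => ‖a i‖) (hb' : Summable fun i => ‖b i‖) :
    HasSum (fun i : ι × κ => a i.1 * b i.2) (A * B) := by
  have h := summable_mul_of_summable_norm ha' hb'
  exact ha.mul hb h

/-- Multiply the two absolutely convergent expansions; for fixed l only finitely many m interact
with k, namely m = k - l - d with d in the cube. -/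
theorem mul_expansion (hρ : IsWindow ρ) (hp1 : p ≠ ∞) {f g : Space n → ℂ}
    (hf : MemLp f p volume) (hg : MemLp g p volume) (hfs : ∑' k, bxNorm ρ p f k ≠ ∞)
    (hgs : ∑' k, bxNorm ρ p g k ≠ ∞) :
    MemLp (fun x => f x * g x) p volume ∧ ∀ k, bxNorm ρ p (fun x => f x * g x) k ≤
      kerOne ρ * nikConst ρ p *
        ∑ d ∈ cube n 3, ∑' l, bxNorm ρ p f l * bxNorm ρ p g (k - l - d) := by
  have hle := eLpNorm_bx_mul_bx_le hρ hf hg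
  have hnik := nikConst_ne_top (p := p) hρ
  have hF : ∀ i : (Fin n → ℤ) × (Fin n → ℤ),
      MemLp (fun x => bx ρ i.1 f x * bx ρ i.2 g x) p volume := fun i => by
    refine ⟨(aestronglyMeasurable_bx hρ _ hf.1).mul (aestronglyMeasurable_bx hρ _ hg.1), ?_⟩
    exact (hle i.1 i.2).trans_lt (ENNReal.mul_lt_top
      (ENNReal.mul_lt_top hnik.lt_top (memLp_bx hρ i.1 hf hp1).2) (memLp_bx hρ i.2 hg hp1).2)
  have hs : ∑' i : (Fin n → ℤ) × (Fin n → ℤ),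
      eLpNorm (fun x => bx ρ i.1 f x * bx ρ i.2 g x) p volume ≠ ∞ := by
    refine ne_top_of_le_ne_top ?_ (ENNReal.tsum_le_tsum fun i => hle i.1 i.2)
    rw [ENNReal.tsum_prod (f := fun l m => nikConst ρ p * bxNorm ρ p f l * bxNorm ρ p g m)]
    simp_rw [ENNReal.tsum_mul_left, ENNReal.tsum_mul_right]
    rw [ENNReal.tsum_mul_left]
    exact ENNReal.mul_ne_top (ENNReal.mul_ne_top hnik hfs) hgs
  have hsum : ∀ᵐ x, HasSum (fun i : (Fin n → ℤ) × (Fin n → ℤ) => bx ρ i.1 f x * bx ρ i.2 g x)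
      (f x * g x) := by
    filter_upwards [ae_hasSum_bx hρ hp1 hf hfs, ae_hasSum_bx hρ hp1 hg hgs] with x h1 h2
    have h3 := summable_norm_bx hρ hf hfs x
    have h4 := summable_norm_bx hρ hg hgs x
    have h5 := hasSum_mul_prod (a := fun k => bx ρ k f x) (b := fun k => bx ρ k g x) h1 h2 h3 h4
    exact h5
  refine ⟨memLp_of_hasSum hF hs hsum, fun k => ?_⟩
  calc bxNorm ρ p (fun x => f x * g x) k
      ≤ ∑' i : (Fin n → ℤ) × (Fin n → ℤ),
          bxNorm ρ p (fun x => bx ρ i.1 f x * bx ρ i.2 g x) k := bxNorm_le_tsum hρ hF hs hsum k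
    _ ≤ ∑' i : (Fin n → ℤ) × (Fin n → ℤ), if k - i.1 - i.2 ∈ cube n 3 then
          kerOne ρ * nikConst ρ p * (bxNorm ρ p f i.1 * bxNorm ρ p g i.2) else 0 :=
        ENNReal.tsum_le_tsum fun i => bxNorm_bx_mul_bx_le hρ hp1 hf hg k i.1 i.2
    _ = ∑' l, ∑ d ∈ cube n 3,
          kerOne ρ * nikConst ρ p * (bxNorm ρ p f l * bxNorm ρ p g (k - l - d)) := by
        rw [ENNReal.tsum_prod (f := fun l m => if k - l - m ∈ cube n 3 then
          kerOne ρ * nikConst ρ p * (bxNorm ρ p f l * bxNorm ρ p g m) else 0)]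
        congr 1 with l
        exact tsum_ite_sub_mem_cube (k - l) fun m =>
          kerOne ρ * nikConst ρ p * (bxNorm ρ p f l * bxNorm ρ p g m)
    _ = _ := by
        rw [Summable.tsum_finsetSum fun _ _ => ENNReal.summable, Finset.mul_sum]
        exact Finset.sum_congr rfl fun d _ => ENNReal.tsum_mul_left

/-! ### Weighted estimates -/

/-- Submultiplicative weights with a gain: `γ` measures the gain, `G` and `H` are constants. -/
structure IsAlgebraWeight (γ W : (Fin n → ℤ) → ℝ≥0∞) (G H : ℝ≥0∞) : Prop where
  le_mul : ∀ k l m, k - l - m ∈ cube n 3 → W k ≤ G * (γ l + γ m) * (W l * W m)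
  one_le : ∀ k, 1 ≤ H * (γ k * W k)

variable {q : ℝ≥0∞} {γ W : (Fin n → ℤ) → ℝ≥0∞} {G H : ℝ≥0∞}

omit hp in
-- The summable gain needs only a bound on the supremum of a, which every ℓ^q norm controls; this is
-- why no condition relating q to the weight appears.
theorem tsum_mul_le_lq (hq : 1 ≤ q) (a : (Fin n → ℤ) → ℝ≥0∞) :
    ∑' k, γ k * a k ≤ (∑' k, γ k) * lq q a := by
  rw [← ENNReal.tsum_mul_right]
  exact ENNReal.tsum_le_tsum fun k => by gcongr; exact le_lq hq a k

omit hp in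
theorem tsum_bxNorm_le (hq : 1 ≤ q) (hW : IsAlgebraWeight γ W G H) (f : Space n → ℂ) :
    ∑' k, bxNorm ρ p f k ≤ H * (∑' k, γ k) * wNorm ρ p q W f := by
  calc ∑' k, bxNorm ρ p f k ≤ ∑' k, H * (γ k * (W k * bxNorm ρ p f k)) := by
        refine ENNReal.tsum_le_tsum fun k => ?_
        calc bxNorm ρ p f k = 1 * bxNorm ρ p f k := (one_mul _).symm
          _ ≤ H * (γ k * W k) * bxNorm ρ p f k := by gcongr; exact hW.one_le k
          _ = _ := by ring
    _ ≤ _ := by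
        rw [ENNReal.tsum_mul_left, mul_assoc]
        gcongr
        exact tsum_mul_le_lq hq _

omit hp in
theorem lq_convolution_le (hq : 1 ≤ q) (a b : (Fin n → ℤ) → ℝ≥0∞) (d : Fin n → ℤ) :
    lq q (fun k => ∑' l, γ l * a l * b (k - l - d)) ≤ (∑' k, γ k) * lq q a * lq q b := by
  refine (lq_tsum_le hq fun l k => γ l * a l * b (k - l - d)).trans ?_
  have : ∀ l, lq q (fun k => γ l * a l * b (k - l - d)) = γ l * a l * lq q b := fun l => by
    rw [lq_const_mul hq]
    congr 1
    rw [← lq_comp_equiv ((Equiv.subRight l).trans (Equiv.subRight d)) b]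
    rfl
  simp_rw [this]
  rw [ENNReal.tsum_mul_right]
  gcongr
  exact tsum_mul_le_lq hq a

/-- The constant in the product estimate, up to the constant `G` of the weight. -/
def mulConst (ρ : Space n → ℝ) (p : ℝ≥0∞) (γ : (Fin n → ℤ) → ℝ≥0∞) : ℝ≥0∞ :=
  kerOne ρ * nikConst ρ p * ((cube n 3).card * (2 * ∑' k, γ k))

omit hp in
theorem mulConst_ne_top (hρ : IsWindow ρ) (hγ : ∑' k, γ k ≠ ∞) : mulConst ρ p γ ≠ ∞ :=
  ENNReal.mul_ne_top (ENNReal.mul_ne_top (kerOne_ne_top hρ) (nikConst_ne_top hρ))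
    (ENNReal.mul_ne_top (ENNReal.natCast_ne_top _) (ENNReal.mul_ne_top (by simp) hγ))

/-- The gain falls on one of the two frequencies. That factor becomes summable, and a convolution
with a summable sequence is bounded on ℓ^q. -/
theorem wNorm_mul_le (hρ : IsWindow ρ) (hp1 : p ≠ ∞) (hq : 1 ≤ q)
    (hW : IsAlgebraWeight γ W G H) {f g : Space n → ℂ}
    (hf : MemLp f p volume) (hg : MemLp g p volume) (hfs : ∑' k, bxNorm ρ p f k ≠ ∞)
    (hgs : ∑' k, bxNorm ρ p g k ≠ ∞) :
    wNorm ρ p q W (fun x => f x * g x)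
      ≤ mulConst ρ p γ * G * wNorm ρ p q W f * wNorm ρ p q W g := by
  set a : (Fin n → ℤ) → ℝ≥0∞ := fun k => W k * bxNorm ρ p f k with ha
  set b : (Fin n → ℤ) → ℝ≥0∞ := fun k => W k * bxNorm ρ p g k with hb
  set C := kerOne ρ * nikConst ρ p
  have h1 : ∀ k, W k * bxNorm ρ p (fun x => f x * g x) k ≤ (C * G) * ∑ d ∈ cube n 3,
      ((∑' l, γ l * a l * b (k - l - d)) + ∑' m, γ m * b m * a (k - m - d)) := fun k => by
    calc W k * bxNorm ρ p (fun x => f x * g x) k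
        ≤ W k * (C * ∑ d ∈ cube n 3, ∑' l, bxNorm ρ p f l * bxNorm ρ p g (k - l - d)) := by
          gcongr; exact (mul_expansion hρ hp1 hf hg hfs hgs).2 k
      _ = C * ∑ d ∈ cube n 3, ∑' l, W k * (bxNorm ρ p f l * bxNorm ρ p g (k - l - d)) := by
          simp_rw [ENNReal.tsum_mul_left, ← Finset.mul_sum]
          ring
      _ ≤ C * ∑ d ∈ cube n 3, G * ((∑' l, γ l * a l * b (k - l - d))
            + ∑' m, γ m * b m * a (k - m - d)) := by
          gcongr with d hd
          -- The second sum carries the gain on the frequency of g; the substitution m = k - l - d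
          -- brings both sums to the same index.
          have hre : ∑' m, γ m * b m * a (k - m - d)
              = ∑' l, γ (k - l - d) * b (k - l - d) * a l := by
            rw [← ((Equiv.subLeft k).trans (Equiv.subRight d)).tsum_eq]
            congr 1 with l
            simp only [Equiv.trans_apply, Equiv.subLeft_apply, Equiv.subRight_apply]
            congr 2
            abel
          rw [hre, ← ENNReal.tsum_add, ← ENNReal.tsum_mul_left]
          refine ENNReal.tsum_le_tsum fun l => ?_
          have hw := hW.le_mul k l (k - l - d) (by simpa using hd)
          calc W k * (bxNorm ρ p f l * bxNorm ρ p g (k - l - d))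
              ≤ G * (γ l + γ (k - l - d)) * (W l * W (k - l - d))
                * (bxNorm ρ p f l * bxNorm ρ p g (k - l - d)) := by gcongr
            _ = _ := by simp only [ha, hb]; ring
      _ = _ := by rw [← Finset.mul_sum, mul_assoc C G]
  calc wNorm ρ p q W (fun x => f x * g x)
      ≤ lq q fun k => (C * G) * ∑ d ∈ cube n 3,
      ((∑' l, γ l * a l * b (k - l - d)) + ∑' m, γ m * b m * a (k - m - d)) := lq_mono h1
    _ ≤ (C * G) * ∑ d ∈ cube n 3, ((∑' k, γ k) * lq q a * lq q b
          + (∑' k, γ k) * lq q b * lq q a) := by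
        rw [lq_const_mul hq]
        gcongr
        refine (lq_sum_le hq _ _).trans (Finset.sum_le_sum fun d _ => ?_)
        refine (lq_add_le hq _ _).trans ?_
        gcongr
        · exact lq_convolution_le hq a b d
        · exact lq_convolution_le hq b a d
    _ = _ := by
        rw [Finset.sum_const, nsmul_eq_mul, mulConst, wNorm, wNorm]
        ring

/-! ### Synthesis from some of the pieces -/

/-- Serves both halves of the frequency splitting: S is a ball or its complement, and only the
weights at k and at retained neighbours k + d have to be compared. -/
theorem wNorm_synthesis_le (hρ : IsWindow ρ) (hp1 : p ≠ ∞) (hq : 1 ≤ q) {f u : Space n → ℂ}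
    (hu : MemLp u p volume) (S : Set (Fin n → ℤ)) [DecidablePred (· ∈ S)]
    (hf : ∀ k x, bx ρ k f x = ∑ d ∈ cube n 2 with k + d ∈ S, bx ρ k (bx ρ (k + d) u) x)
    {W' : (Fin n → ℤ) → ℝ≥0∞} {D : ℝ≥0∞}
    (hD : ∀ k, ∀ d ∈ cube n 2, k + d ∈ S → W' k ≤ D * W (k + d)) :
    wNorm ρ p q W' f ≤ (cube n 2).card * (D * kerOne ρ) * wNorm ρ p q W u := by
  have h1 : ∀ k, W' k * bxNorm ρ p f k
      ≤ ∑ d ∈ cube n 2, (D * kerOne ρ) * (W (k + d) * bxNorm ρ p u (k + d)) := fun k => by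
    have hk : bx ρ k f = ∑ d ∈ cube n 2 with k + d ∈ S, bx ρ k (bx ρ (k + d) u) := by
      ext x; rw [hf k x, Finset.sum_apply]
    calc W' k * bxNorm ρ p f k
        ≤ W' k * ∑ d ∈ cube n 2 with k + d ∈ S, kerOne ρ * bxNorm ρ p u (k + d) := by
          gcongr
          rw [bxNorm, hk]
          have hm : ∀ d, AEStronglyMeasurable (bx ρ (k + d) u) volume := fun d =>
            aestronglyMeasurable_bx hρ _ hu.1
          refine (eLpNorm_sum_le (fun d _ => aestronglyMeasurable_bx hρ k (hm d)) hp.out).trans ?_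
          exact Finset.sum_le_sum fun d _ => bxNorm_le hρ hp1 (hm d) k
      _ = ∑ d ∈ cube n 2 with k + d ∈ S, W' k * (kerOne ρ * bxNorm ρ p u (k + d)) :=
          Finset.mul_sum _ _ _
      _ ≤ ∑ d ∈ cube n 2 with k + d ∈ S,
            (D * kerOne ρ) * (W (k + d) * bxNorm ρ p u (k + d)) := by
          refine Finset.sum_le_sum fun d hd => ?_
          rw [Finset.mem_filter] at hd
          calc W' k * (kerOne ρ * bxNorm ρ p u (k + d))
              ≤ D * W (k + d) * (kerOne ρ * bxNorm ρ p u (k + d)) := by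
                gcongr; exact hD k d hd.1 hd.2
            _ = _ := by ring
      _ ≤ _ := Finset.sum_le_sum_of_subset (Finset.filter_subset _ _)
  refine (lq_mono h1).trans ((lq_sum_le hq _ _).trans_eq ?_)
  have : ∀ d, lq q (fun k => (D * kerOne ρ) * (W (k + d) * bxNorm ρ p u (k + d)))
      = (D * kerOne ρ) * wNorm ρ p q W u := fun d => by
    rw [lq_const_mul hq]
    congr 1
    exact lq_comp_equiv (Equiv.addRight d) fun k => W k * bxNorm ρ p u k
  simp_rw [this]
  rw [Finset.sum_const, nsmul_eq_mul, ← mul_assoc]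

theorem bx_sum_bx (hρ : IsWindow ρ) (hp1 : p ≠ ∞) {u : Space n → ℂ} (hu : MemLp u p volume)
    (S : Finset (Fin n → ℤ)) (k : Fin n → ℤ) (x : Space n) :
    bx ρ k (fun y => ∑ l ∈ S, bx ρ l u y) x
      = ∑ d ∈ cube n 2 with k + d ∈ S, bx ρ k (bx ρ (k + d) u) x := by
  rw [bx_finsetSum hρ k S fun l _ => memLp_bx hρ l hu hp1, Finset.sum_filter]
  calc ∑ l ∈ S, bx ρ k (bx ρ l u) x
      = ∑' l, if l ∈ S then bx ρ k (bx ρ l u) x else 0 := by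
        rw [tsum_eq_sum (s := S) fun l hl => if_neg hl]
        exact Finset.sum_congr rfl fun l hl => (if_pos hl).symm
    _ = ∑' d, if k + d ∈ S then bx ρ k (bx ρ (k + d) u) x else 0 :=
        ((Equiv.addLeft k).tsum_eq fun l => if l ∈ S then bx ρ k (bx ρ l u) x else 0).symm
    _ = _ := tsum_eq_sum fun d hd => by
        rw [bx_bx_eq_zero hρ (by simpa using hd) hu, ite_self]

theorem bx_sub_sum_bx (hρ : IsWindow ρ) (hp1 : p ≠ ∞) {u : Space n → ℂ} (hu : MemLp u p volume)
    (S : Finset (Fin n → ℤ)) (k : Fin n → ℤ) (x : Space n) :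
    bx ρ k (fun y => u y - ∑ l ∈ S, bx ρ l u y) x
      = ∑ d ∈ cube n 2 with k + d ∉ S, bx ρ k (bx ρ (k + d) u) x := by
  rw [bx_sub hρ k hu (memLp_finsetSum _ fun l _ => memLp_bx hρ l hu hp1),
    bx_sum_bx hρ hp1 hu, ← sum_bx_bx hρ k hu, sub_eq_iff_eq_add',
    Finset.sum_filter_add_sum_filter_not]

/-! ### The exponential function -/

/-- Powers start at exponent one, since constants need not lie in L^p. Finiteness of the weighted
norm is carried along because it makes the pieces of each power summable, as the product estimate
requires. -/
theorem wNorm_pow_le (hρ : IsWindow ρ) (hp1 : p ≠ ∞) (hq : 1 ≤ q)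
    (hW : IsAlgebraWeight γ W G H) (hγ : ∑' k, γ k ≠ ∞) (hG : G ≠ ∞) (hH : H ≠ ∞)
    {f : Space n → ℂ} (hf : MemLp f p volume) (hN : wNorm ρ p q W f ≠ ∞) (m : ℕ) :
    MemLp (fun x => f x ^ (m + 1)) p volume ∧
      wNorm ρ p q W (fun x => f x ^ (m + 1))
        ≤ (mulConst ρ p γ * G) ^ m * wNorm ρ p q W f ^ (m + 1) := by
  have hfin : ∀ g : Space n → ℂ, wNorm ρ p q W g ≠ ∞ → ∑' k, bxNorm ρ p g k ≠ ∞ := fun g hg =>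
    ne_top_of_le_ne_top (ENNReal.mul_ne_top (ENNReal.mul_ne_top hH hγ) hg)
      (tsum_bxNorm_le hq hW g)
  have hK : mulConst ρ p γ * G ≠ ∞ := ENNReal.mul_ne_top (mulConst_ne_top hρ hγ) hG
  induction m with
  | zero => simpa using hf
  | succ m ih =>
    have h1 := hfin _ (ne_top_of_le_ne_top
      (ENNReal.mul_ne_top (ENNReal.pow_ne_top hK) (ENNReal.pow_ne_top hN)) ih.2)
    have h2 := mul_expansion hρ hp1 ih.1 hf h1 (hfin f hN)
    have h3 := wNorm_mul_le hρ hp1 hq hW ih.1 hf h1 (hfin f hN)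
    simp_rw [pow_succ _ (m + 1)]
    refine ⟨h2.1, h3.trans ?_⟩
    calc mulConst ρ p γ * G * wNorm ρ p q W (fun x => f x ^ (m + 1)) * wNorm ρ p q W f
        ≤ mulConst ρ p γ * G * ((mulConst ρ p γ * G) ^ m * wNorm ρ p q W f ^ (m + 1))
          * wNorm ρ p q W f := by gcongr; exact ih.2
      _ = _ := by ring

theorem hasSum_exp_sub_one (z : ℂ) :
    HasSum (fun m : ℕ => Complex.I ^ (m + 1) / (m + 1).factorial * z ^ (m + 1))
      (Complex.exp (Complex.I * z) - 1) := by
  have h := NormedSpace.expSeries_div_hasSum_exp (𝔸 := ℂ) (Complex.I * z)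
  rw [← Complex.exp_eq_exp_ℂ] at h
  have h1 := (hasSum_nat_add_iff' 1).2 h
  simp only [Finset.range_one, Finset.sum_singleton, pow_zero, Nat.factorial_zero, Nat.cast_one,
    div_one] at h1
  have h2 : (fun m : ℕ => Complex.I ^ (m + 1) / (m + 1).factorial * z ^ (m + 1))
      = fun m : ℕ => (Complex.I * z) ^ (m + 1) / (m + 1).factorial := by
    ext m; ring
  rw [h2]
  exact h1

/-- Replacing 1/(m+1)! by 1/m! leaves one factor N outside the exponential series; it becomes the
linear factor of the final estimate. -/
theorem tsum_factorial_mul_le {K N : ℝ≥0∞} (h : K * N ≠ ∞) :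
    ∑' m : ℕ, ENNReal.ofReal (1 / (m + 1).factorial) * (K ^ m * N ^ (m + 1))
      ≤ N * ENNReal.ofReal (Real.exp (K * N).toReal) := by
  set X := (K * N).toReal
  have h1 : HasSum (fun m : ℕ => X ^ m / m.factorial) (Real.exp X) := by
    have := NormedSpace.expSeries_div_hasSum_exp (𝔸 := ℝ) X
    rwa [← Real.exp_eq_exp_ℝ] at this
  rw [← h1.tsum_eq, ENNReal.ofReal_tsum_of_nonneg (fun m => by positivity) h1.summable,
    ← ENNReal.tsum_mul_left]
  refine ENNReal.tsum_le_tsum fun m => ?_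
  have h2 : ENNReal.ofReal (X ^ m / m.factorial)
      = ENNReal.ofReal (1 / m.factorial) * (K * N) ^ m := by
    rw [div_eq_mul_one_div, ENNReal.ofReal_mul (by positivity), mul_comm,
      ENNReal.ofReal_pow ENNReal.toReal_nonneg, ENNReal.ofReal_toReal h]
  rw [h2]
  calc ENNReal.ofReal (1 / (m + 1).factorial) * (K ^ m * N ^ (m + 1))
      ≤ ENNReal.ofReal (1 / m.factorial) * (K ^ m * N ^ (m + 1)) := by
        gcongr
        exact Nat.le_succ m
    _ = _ := by rw [mul_pow]; ring

theorem wNorm_exp_sub_one_le (hρ : IsWindow ρ) (hp1 : p ≠ ∞) (hq : 1 ≤ q)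
    (hW : IsAlgebraWeight γ W G H) (hγ : ∑' k, γ k ≠ ∞) (hG : G ≠ ∞) (hH : H ≠ ∞)
    {f : Space n → ℂ} (hf : MemLp f p volume) (hN : wNorm ρ p q W f ≠ ∞) :
    MemLp (fun x => Complex.exp (Complex.I * f x) - 1) p volume ∧
      wNorm ρ p q W (fun x => Complex.exp (Complex.I * f x) - 1)
        ≤ wNorm ρ p q W f
          * ENNReal.ofReal (Real.exp (mulConst ρ p γ * G * wNorm ρ p q W f).toReal) := by
  set K := mulConst ρ p γ * G
  set N := wNorm ρ p q W f
  have hK : K ≠ ∞ := ENNReal.mul_ne_top (mulConst_ne_top hρ hγ) hG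
  have hKN : K * N ≠ ∞ := ENNReal.mul_ne_top hK hN
  have hpow := wNorm_pow_le hρ hp1 hq hW hγ hG hH hf hN
  set c : ℕ → ℂ := fun m => Complex.I ^ (m + 1) / (m + 1).factorial with hc
  have hcn : ∀ m, ‖c m‖ₑ = ENNReal.ofReal (1 / (m + 1).factorial) := fun m => by
    rw [← ofReal_norm]
    simp [hc]
  have hm : ∀ m, MemLp (fun x => c m * f x ^ (m + 1)) p volume := fun m =>
    (hpow m).1.const_mul (c m)
  have hbound := tsum_factorial_mul_le hKN
  have hfin : N * ENNReal.ofReal (Real.exp (K * N).toReal) ≠ ∞ :=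
    ENNReal.mul_ne_top hN ENNReal.ofReal_ne_top
  have hLp : ∀ m, eLpNorm (fun x => c m * f x ^ (m + 1)) p volume
      ≤ H * (∑' k, γ k) * (ENNReal.ofReal (1 / (m + 1).factorial) * (K ^ m * N ^ (m + 1))) :=
    fun m => by
    have h1 : eLpNorm (fun x => f x ^ (m + 1)) p volume
        ≤ H * (∑' k, γ k) * (K ^ m * N ^ (m + 1)) := by
      have h2 : ∑' k, bxNorm ρ p (fun x => f x ^ (m + 1)) k
          ≤ H * (∑' k, γ k) * (K ^ m * N ^ (m + 1)) :=
        (tsum_bxNorm_le hq hW _).trans (by gcongr; exact (hpow m).2)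
      refine (eLpNorm_le_tsum_bxNorm hρ hp1 (hpow m).1 (ne_top_of_le_ne_top ?_ h2)).trans h2
      exact ENNReal.mul_ne_top (ENNReal.mul_ne_top hH hγ)
        (ENNReal.mul_ne_top (ENNReal.pow_ne_top hK) (ENNReal.pow_ne_top hN))
    have h3 : (fun x => c m * f x ^ (m + 1)) = c m • fun x => f x ^ (m + 1) := rfl
    rw [h3, eLpNorm_const_smul, hcn, mul_left_comm]
    gcongr
  have hs : ∑' m, eLpNorm (fun x => c m * f x ^ (m + 1)) p volume ≠ ∞ := by
    refine ne_top_of_le_ne_top ?_ (ENNReal.tsum_le_tsum hLp)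
    rw [ENNReal.tsum_mul_left]
    exact ENNReal.mul_ne_top (ENNReal.mul_ne_top hH hγ) (ne_top_of_le_ne_top hfin hbound)
  have hsum : ∀ᵐ x, HasSum (fun m => c m * f x ^ (m + 1)) (Complex.exp (Complex.I * f x) - 1) :=
    Filter.Eventually.of_forall fun x => hasSum_exp_sub_one (f x)
  refine ⟨memLp_of_hasSum hm hs hsum, le_trans ?_ hbound⟩
  calc wNorm ρ p q W (fun x => Complex.exp (Complex.I * f x) - 1)
      ≤ lq q fun k => ∑' m, ‖c m‖ₑ * (W k * bxNorm ρ p (fun x => f x ^ (m + 1)) k) := by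
        refine lq_mono fun k => ?_
        have h1 := bxNorm_le_tsum hρ hm hs hsum k
        simp_rw [bxNorm_const_mul] at h1
        calc _ ≤ W k * ∑' m, ‖c m‖ₑ * bxNorm ρ p (fun x => f x ^ (m + 1)) k := by gcongr
          _ = _ := by
            rw [← ENNReal.tsum_mul_left]
            congr 1 with m
            ring
    _ ≤ ∑' m, ‖c m‖ₑ * wNorm ρ p q W (fun x => f x ^ (m + 1)) := by
        refine (lq_tsum_le hq _).trans_eq ?_
        simp_rw [lq_const_mul hq]
        rfl
    _ ≤ _ := ENNReal.tsum_le_tsum fun m => by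
        rw [hcn]
        gcongr
        exact (hpow m).2

end

end GevreyModulation

end

noncomputable section

namespace GevreyModulation

/-! ### Subexponential weights -/

/-- Both a and 2b are convex combinations of b and a + b, with the weights b/a and 1 - b/a
interchanged. Adding the two concavity inequalities gives b^α + (a+b)^α ≤ a^α + (2b)^α. -/
theorem add_rpow_le_of_le {α a b : ℝ} (h0 : 0 ≤ α) (h1 : α ≤ 1) (hb : 0 ≤ b) (hab : b ≤ a) :
    (a + b) ^ α ≤ a ^ α + (2 ^ α - 1) * b ^ α := by
  rcases hb.eq_or_lt with rfl | hb'
  · rcases h0.eq_or_lt with rfl | h0'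
    · simp
    · simp [Real.zero_rpow h0'.ne']
  have ha : 0 < a := hb'.trans_le hab
  have hc := (Real.concaveOn_rpow h0 h1).2
  have hl0 : 0 ≤ b / a := by positivity
  have hl1 : 0 ≤ 1 - b / a := by rw [sub_nonneg, div_le_one ha]; exact hab
  have e1 := hc (Set.mem_Ici.2 hb) (Set.mem_Ici.2 (by positivity : 0 ≤ a + b)) hl0 hl1 (by ring)
  have e2 := hc (Set.mem_Ici.2 hb) (Set.mem_Ici.2 (by positivity : 0 ≤ a + b)) hl1 hl0 (by ring)
  simp only [smul_eq_mul] at e1 e2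
  have f1 : b / a * b + (1 - b / a) * (a + b) = a := by field_simp; ring
  have f2 : (1 - b / a) * b + b / a * (a + b) = 2 * b := by field_simp; ring
  rw [f1] at e1
  rw [f2, Real.mul_rpow zero_le_two hb] at e2
  linarith

/-- Half of the gain in the subadditivity of `t ↦ t ^ α`. -/
def gain (α : ℝ) : ℝ := (2 - 2 ^ α) / 2

theorem gain_pos {α : ℝ} (h1 : α < 1) : 0 < gain α := by
  have : (2 : ℝ) ^ α < 2 ^ (1 : ℝ) := Real.rpow_lt_rpow_of_exponent_lt one_lt_two h1
  rw [Real.rpow_one] at this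
  rw [gain]; linarith

theorem gain_le_half {α : ℝ} (h0 : 0 ≤ α) : gain α ≤ 1 / 2 := by
  have : (1 : ℝ) ≤ 2 ^ α := Real.one_le_rpow one_le_two h0
  rw [gain]; linarith

theorem add_rpow_le_sub_gain {α a b : ℝ} (h0 : 0 ≤ α) (h1 : α ≤ 1) (ha : 0 ≤ a) (hb : 0 ≤ b) :
    (a + b) ^ α ≤ a ^ α + b ^ α - 2 * gain α * min a b ^ α := by
  rcases le_total a b with h | h
  · have := add_rpow_le_of_le h0 h1 ha h
    rw [min_eq_left h, gain, add_comm a]; linarith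
  · have := add_rpow_le_of_le h0 h1 hb h
    rw [min_eq_right h, gain]; linarith

section

variable {n : ℕ}

/-- The weight `exp(ε|k| + max(|k|,R)^α)`. -/
def gevreyWeight (n : ℕ) (α ε R : ℝ) (k : Fin n → ℤ) : ℝ≥0∞ :=
  ENNReal.ofReal (Real.exp (ε * ‖latticePoint k‖ + max ‖latticePoint k‖ R ^ α))

/-- The gain `exp(-gain(α) |k|^α)`. -/
def gevreyGain (n : ℕ) (α : ℝ) (k : Fin n → ℤ) : ℝ≥0∞ :=
  ENNReal.ofReal (Real.exp (-(gain α * ‖latticePoint k‖ ^ α)))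

theorem norm_latticePoint_le {r : ℕ} {d : Fin n → ℤ} (hd : d ∈ cube n r) :
    ‖latticePoint d‖ ≤ r * √n := by
  rw [EuclideanSpace.norm_eq]
  refine Real.sqrt_le_iff.2 ⟨by positivity, ?_⟩
  calc ∑ i, ‖latticePoint d i‖ ^ 2 ≤ ∑ _i : Fin n, (r : ℝ) ^ 2 := by
        refine Finset.sum_le_sum fun i _ => pow_le_pow_left₀ (norm_nonneg _) ?_ 2
        have := mem_cube.1 hd i
        rw [latticePoint_apply, Real.norm_eq_abs]
        exact_mod_cast this
    _ = (r * √n) ^ 2 := by rw [mul_pow, Real.sq_sqrt (by positivity)]; simp [mul_comm]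

theorem tsum_prod_pi {ι : Type*} (f : ι → ℝ≥0∞) (n : ℕ) :
    ∑' k : Fin n → ι, ∏ i, f (k i) = (∑' j, f j) ^ n := by
  induction n with
  | zero => simp [tsum_fintype]
  | succ n ih =>
    rw [← (Fin.consEquiv fun _ => ι).tsum_eq, ENNReal.tsum_prod']
    simp only [Fin.consEquiv_apply, Fin.prod_univ_succ, Fin.cons_zero, Fin.cons_succ]
    simp_rw [ENNReal.tsum_mul_left, ENNReal.tsum_mul_right, ih]
    ring

theorem summable_exp_neg_rpow_int {α c : ℝ} (hα : 0 < α) (hc : 0 < c) :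
    Summable fun j : ℤ => Real.exp (-(c * |(j : ℝ)| ^ α)) := by
  -- From x^N/N! ≤ e^x with x = c|j|^α the terms decay like |j|^{-αN}, and αN > 2 is more than
  -- enough.
  obtain ⟨N, hN⟩ := exists_nat_gt (2 / α)
  have hN2 : 1 < α * N := by
    rw [div_lt_iff₀ hα] at hN; linarith
  refine Summable.of_norm_bounded_eventually
    ((Real.summable_abs_int_rpow hN2).mul_left (N.factorial / c ^ N)) ?_
  have : ∀ᶠ j : ℤ in Filter.cofinite, j ≠ 0 := (Set.finite_singleton (0 : ℤ)).compl_mem_cofinite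
  filter_upwards [this] with j hj
  have hj' : 0 < |(j : ℝ)| := by simpa using hj
  have h1 := Real.pow_div_factorial_le_exp (c * |(j : ℝ)| ^ α) (by positivity) N
  rw [Real.norm_eq_abs, Real.abs_exp, Real.exp_neg, Real.rpow_neg hj'.le, Real.rpow_mul hj'.le,
    Real.rpow_natCast]
  rw [inv_le_comm₀ (Real.exp_pos _) (by positivity)]
  refine le_trans (le_of_eq ?_) h1
  rw [mul_pow]
  field_simp

theorem tsum_gevreyGain_ne_top {α : ℝ} (h0 : 0 < α) (h1 : α < 1) :
    ∑' k, gevreyGain n α k ≠ ∞ := by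
  -- Bounding each |k_i| by |k| splits the sum into a product of one-dimensional sums. The
  -- denominator n + 1 rather than n excludes division by zero.
  set c := gain α / (n + 1) with hc
  have hc0 : 0 < c := div_pos (gain_pos h1) (by positivity)
  have h2 : ∑' j : ℤ, ENNReal.ofReal (Real.exp (-(c * |(j : ℝ)| ^ α))) ≠ ∞ :=
    (summable_exp_neg_rpow_int h0 hc0).tsum_ofReal_ne_top
  refine ne_top_of_le_ne_top (ENNReal.pow_ne_top (n := n) h2) ?_
  rw [← tsum_prod_pi]
  refine ENNReal.tsum_le_tsum fun k => ?_
  rw [gevreyGain, ← ENNReal.ofReal_prod_of_nonneg fun i _ => (Real.exp_pos _).le, ← Real.exp_sum]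
  refine ENNReal.ofReal_le_ofReal (Real.exp_le_exp.2 ?_)
  rw [Finset.sum_neg_distrib, neg_le_neg_iff, ← Finset.mul_sum]
  calc c * ∑ i, |(k i : ℝ)| ^ α ≤ c * ∑ _i : Fin n, ‖latticePoint k‖ ^ α := by
        gcongr with i
        exact PiLp.norm_apply_le (latticePoint k) i
    _ = (c * n) * ‖latticePoint k‖ ^ α := by
        rw [Finset.sum_const, Finset.card_univ, Fintype.card_fin, nsmul_eq_mul, mul_assoc]
    _ ≤ gain α * ‖latticePoint k‖ ^ α := by
        gcongr
        rw [hc, div_mul_eq_mul_div, div_le_iff₀ (by positivity)]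
        have := gain_pos h1
        nlinarith

/-- The part of the constant of the weight that does not depend on `R`. -/
def weightConst (n : ℕ) (α : ℝ) : ℝ := Real.exp (3 * √n + (3 * √n) ^ α)

/-- The small factor `exp(-gain(α) R^α)`. -/
def smallFactor (α R : ℝ) : ℝ := Real.exp (-(gain α * R ^ α))

theorem isAlgebraWeight_gevreyWeight {α ε R : ℝ} (h0 : 0 < α) (h1 : α < 1) (hε : 0 ≤ ε)
    (hε1 : ε ≤ 1) (hR : 0 ≤ R) :
    IsAlgebraWeight (gevreyGain n α) (gevreyWeight n α ε R)
      (ENNReal.ofReal (weightConst n α * smallFactor α R)) (ENNReal.ofReal (smallFactor α R)) := by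
  have hg := gain_pos h1
  have hg2 := gain_le_half h0.le
  constructor
  · intro k l m hd
    set a := max ‖latticePoint l‖ R
    set b := max ‖latticePoint m‖ R
    set D : ℝ := 3 * √n
    have hD : 0 ≤ D := by positivity
    have ha : 0 ≤ a := hR.trans (le_max_right _ _)
    have hb : 0 ≤ b := hR.trans (le_max_right _ _)
    have hk : ‖latticePoint k‖ ≤ ‖latticePoint l‖ + ‖latticePoint m‖ + D := by
      have e : latticePoint k = latticePoint l + latticePoint m + latticePoint (k - l - m) := by
        rw [latticePoint_sub, latticePoint_sub]; abel
      rw [e]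
      have := norm_latticePoint_le hd
      exact (norm_add_le _ _).trans (add_le_add (norm_add_le _ _) (by exact_mod_cast this))
    have hmax : max ‖latticePoint k‖ R ≤ a + b + D := by
      refine max_le (hk.trans ?_) ?_
      · gcongr
        · exact le_max_left _ _
        · exact le_max_left _ _
      · have : R ≤ a := le_max_right _ _
        linarith
    have e1 : max ‖latticePoint k‖ R ^ α ≤ (a + b) ^ α + D ^ α :=
      (Real.rpow_le_rpow (hR.trans (le_max_right _ _)) hmax h0.le).trans
        (Real.rpow_add_le_add_rpow (by positivity) hD h0.le h1.le)
    have e2 := add_rpow_le_sub_gain h0.le h1.le ha hb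
    have e3 : R ^ α ≤ min a b ^ α := Real.rpow_le_rpow hR
      (le_min (le_max_right _ _) (le_max_right _ _)) h0.le
    have e4 : min ‖latticePoint l‖ ‖latticePoint m‖ ^ α ≤ min a b ^ α :=
      Real.rpow_le_rpow (le_min (norm_nonneg _) (norm_nonneg _))
        (min_le_min (le_max_left _ _) (le_max_left _ _)) h0.le
    have e5 : ε * ‖latticePoint k‖ ≤ ε * ‖latticePoint l‖ + ε * ‖latticePoint m‖ + D := by
      have := mul_le_mul_of_nonneg_left hk hε
      have := mul_le_mul_of_nonneg_right hε1 hD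
      linarith
    -- The gain 2g min(a,b)^α is spent in two halves: since a, b ≥ R, one half yields the small
    -- factor e^{-gR^α}; the other yields the summable gain at l or m.
    have e6 : ε * ‖latticePoint k‖ + max ‖latticePoint k‖ R ^ α
        ≤ (D + D ^ α) + -(gain α * R ^ α)
          + -(gain α * min ‖latticePoint l‖ ‖latticePoint m‖ ^ α)
          + ((ε * ‖latticePoint l‖ + a ^ α) + (ε * ‖latticePoint m‖ + b ^ α)) := by
      have := mul_le_mul_of_nonneg_left e3 hg.le
      have := mul_le_mul_of_nonneg_left e4 hg.le
      linarith
    have e7 : Real.exp (-(gain α * min ‖latticePoint l‖ ‖latticePoint m‖ ^ α))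
        ≤ Real.exp (-(gain α * ‖latticePoint l‖ ^ α))
          + Real.exp (-(gain α * ‖latticePoint m‖ ^ α)) := by
      rcases min_choice ‖latticePoint l‖ ‖latticePoint m‖ with h | h <;> rw [h]
      · linarith [Real.exp_pos (-(gain α * ‖latticePoint m‖ ^ α))]
      · linarith [Real.exp_pos (-(gain α * ‖latticePoint l‖ ^ α))]
    unfold gevreyWeight gevreyGain weightConst smallFactor
    rw [← ENNReal.ofReal_add (Real.exp_pos _).le (Real.exp_pos _).le,
      ← ENNReal.ofReal_mul (Real.exp_pos _).le, ← ENNReal.ofReal_mul (by positivity),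
      ← ENNReal.ofReal_mul (by positivity)]
    refine ENNReal.ofReal_le_ofReal ((Real.exp_le_exp.2 e6).trans ?_)
    rw [Real.exp_add, Real.exp_add, Real.exp_add, Real.exp_add (ε * ‖latticePoint l‖ + a ^ α)]
    gcongr
  · intro k
    unfold gevreyWeight gevreyGain smallFactor
    rw [← ENNReal.ofReal_mul (Real.exp_pos _).le, ← ENNReal.ofReal_mul (Real.exp_pos _).le,
      ← Real.exp_add, ← Real.exp_add]
    -- As g ≤ 1/2, each of the two negative terms is paid for by half of max(|k|,R)^α.
    refine ENNReal.one_le_ofReal.2 (Real.one_le_exp ?_)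
    have i1 : R ^ α ≤ max ‖latticePoint k‖ R ^ α := Real.rpow_le_rpow hR (le_max_right _ _) h0.le
    have i2 : ‖latticePoint k‖ ^ α ≤ max ‖latticePoint k‖ R ^ α :=
      Real.rpow_le_rpow (norm_nonneg _) (le_max_left _ _) h0.le
    have i3 : 0 ≤ R ^ α := Real.rpow_nonneg hR _
    have i4 : 0 ≤ ‖latticePoint k‖ ^ α := Real.rpow_nonneg (norm_nonneg _) _
    have i5 : 0 ≤ ε * ‖latticePoint k‖ := mul_nonneg hε (norm_nonneg _)
    nlinarith [mul_le_mul_of_nonneg_right hg2 i3, mul_le_mul_of_nonneg_right hg2 i4]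

end

end GevreyModulation

end

noncomputable section

namespace GevreyModulation

/-! ### The exponential of a real-valued function -/

theorem norm_exp_I_mul_sub_one_le {z : ℂ} (hz : |z.im| ≤ 1) :
    ‖Complex.exp (Complex.I * z) - 1‖ ≤ 5 * ‖z‖ := by
  -- Separate the modulus e^{-Im z} from the phase: the phase term contributes e^{-Im z}|z| ≤ 3|z|
  -- and the modulus term 2|z|, hence the constant 5.
  have e : Complex.exp (Complex.I * z) - 1 = (Real.exp (-z.im) : ℂ)
      * (Complex.exp (Complex.I * z.re) - 1) + ((Real.exp (-z.im) - 1 : ℝ) : ℂ) := by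
    have : Complex.I * z = ((-z.im : ℝ) : ℂ) + Complex.I * z.re := by
      apply Complex.ext <;> simp
    rw [this, Complex.exp_add]
    push_cast
    ring
  have h1 : ‖Complex.exp (Complex.I * z.re) - 1‖ ≤ ‖z‖ :=
    Real.norm_exp_I_mul_ofReal_sub_one_le.trans (Complex.abs_re_le_norm z)
  have h2 : |Real.exp (-z.im) - 1| ≤ 2 * ‖z‖ := by
    have := Real.abs_exp_sub_one_le (x := -z.im) (by rwa [abs_neg])
    rw [abs_neg] at this
    linarith [Complex.abs_im_le_norm z]
  have h3 : Real.exp (-z.im) ≤ 3 :=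
    (Real.exp_le_exp.2 (by linarith [neg_abs_le z.im])).trans Real.exp_one_lt_three.le
  rw [e]
  refine (norm_add_le _ _).trans ?_
  rw [norm_mul, Complex.norm_real, Complex.norm_real, Real.norm_eq_abs, Real.norm_eq_abs,
    abs_of_pos (Real.exp_pos _)]
  nlinarith [norm_nonneg z, norm_nonneg (Complex.exp (Complex.I * z.re) - 1)]

section

variable {n : ℕ} {ρ : Space n → ℝ} {p q : ℝ≥0∞} [hp : Fact (1 ≤ p)] {α : ℝ}

theorem gmENormFun_eq (hρ : IsWindow ρ) (hp1 : p ≠ ∞) (s : ℝ) {f : Space n → ℂ}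
    (hf : MemLp f p volume) :
    gmENormFun s p q ρ f = wNorm ρ p q (gevreyWeight n (1 / s) 0 0) f := by
  have h : ∀ k, gmTerm s p ρ (Lp.toTemperedDistribution (hf.toLp f)) k
      = gevreyWeight n (1 / s) 0 0 k * bxNorm ρ p f k := fun k => by
    rw [gmTerm, lpENorm_box hρ k hf hp1, bxNorm, gevreyWeight, zero_mul, zero_add,
      max_eq_left (norm_nonneg _)]
  rw [gmENormFun, dif_pos hf, gmENorm, wNorm, lq]
  simp_rw [h]

omit hp in
theorem wNorm_mono {W W' : (Fin n → ℤ) → ℝ≥0∞} (h : ∀ k, W k ≤ W' k) (f : Space n → ℂ) :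
    wNorm ρ p q W f ≤ wNorm ρ p q W' f :=
  lq_mono fun k => by gcongr; exact h k

theorem wNorm_add_le (hρ : IsWindow ρ) (hq : 1 ≤ q) (W : (Fin n → ℤ) → ℝ≥0∞)
    {f g : Space n → ℂ} (hf : MemLp f p volume) (hg : MemLp g p volume) :
    wNorm ρ p q W (fun x => f x + g x) ≤ wNorm ρ p q W f + wNorm ρ p q W g := by
  refine le_trans (lq_mono fun k => ?_) (lq_add_le hq _ _)
  rw [← mul_add]
  gcongr
  have : bx ρ k (fun x => f x + g x) = bx ρ k f + bx ρ k g := by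
    ext x
    simp_rw [Pi.add_apply, bx, mul_add]
    exact integral_add (integrable_ker_mul hρ k hf x) (integrable_ker_mul hρ k hg x)
  rw [bxNorm, this]
  exact eLpNorm_add_le (aestronglyMeasurable_bx hρ k hf.1) (aestronglyMeasurable_bx hρ k hg.1)
    hp.out

/-- The lattice points in the ball of radius `R`. -/
def latticeBall (n : ℕ) (R : ℝ) : Finset (Fin n → ℤ) :=
  (cube n ⌈R⌉₊).filter fun k => ‖latticePoint k‖ ≤ R

theorem mem_latticeBall {R : ℝ} {k : Fin n → ℤ} :
    k ∈ latticeBall n R ↔ ‖latticePoint k‖ ≤ R := by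
  refine ⟨fun h => (Finset.mem_filter.1 h).2, fun h => Finset.mem_filter.2 ⟨?_, h⟩⟩
  refine mem_cube.2 fun i => ?_
  have h1 : |(k i : ℝ)| ≤ ⌈R⌉₊ :=
    ((PiLp.norm_apply_le (latticePoint k) i).trans h).trans (Nat.le_ceil R)
  exact_mod_cast h1

/-- The constant in the comparison of the weights at neighbouring lattice points. -/
def neighbourConst (n : ℕ) (α : ℝ) : ℝ := Real.exp (1 + 2 * √n + (2 * √n) ^ α)

theorem norm_latticePoint_le_add (k : Fin n → ℤ) {d : Fin n → ℤ} (hd : d ∈ cube n 2) :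
    ‖latticePoint k‖ ≤ ‖latticePoint (k + d)‖ + 2 * √n := by
  have e : latticePoint k = latticePoint (k + d) - latticePoint d := by
    rw [latticePoint_add]; abel
  have h := norm_latticePoint_le hd
  rw [e]
  exact (norm_sub_le _ _).trans (add_le_add le_rfl (by exact_mod_cast h))

theorem rpow_norm_latticePoint_le (h0 : 0 < α) (h1 : α < 1) (k : Fin n → ℤ) {d : Fin n → ℤ}
    (hd : d ∈ cube n 2) :
    ‖latticePoint k‖ ^ α ≤ ‖latticePoint (k + d)‖ ^ α + (2 * √n) ^ α :=
  (Real.rpow_le_rpow (norm_nonneg _) (norm_latticePoint_le_add k hd) h0.le).trans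
    (Real.rpow_add_le_add_rpow (norm_nonneg _) (by positivity) h0.le h1.le)

/-- Within distance R of the origin, up to neighbours, the factor e^{|k|/R} is bounded, so the
stronger weight is free for the low-frequency part. -/
theorem gevreyWeight_low_le (h0 : 0 < α) (h1 : α < 1) {R : ℝ} (hR : 1 ≤ R) (k : Fin n → ℤ)
    {d : Fin n → ℤ} (hd : d ∈ cube n 2) (hk : k + d ∈ latticeBall n R) :
    gevreyWeight n α (1 / R) 0 k
      ≤ ENNReal.ofReal (neighbourConst n α) * gevreyWeight n α 0 0 (k + d) := by
  unfold gevreyWeight neighbourConst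
  rw [← ENNReal.ofReal_mul (Real.exp_pos _).le, ← Real.exp_add]
  refine ENNReal.ofReal_le_ofReal (Real.exp_le_exp.2 ?_)
  rw [max_eq_left (norm_nonneg _), max_eq_left (norm_nonneg _)]
  have e1 := rpow_norm_latticePoint_le h0 h1 k hd
  have e2 : 1 / R * ‖latticePoint k‖ ≤ 1 + 2 * √n := by
    have hR0 : 0 < R := zero_lt_one.trans_le hR
    rw [one_div_mul_eq_div, div_le_iff₀ hR0]
    have := norm_latticePoint_le_add k hd
    have := mem_latticeBall.1 hk
    have : 2 * √(n : ℝ) ≤ 2 * √n * R := le_mul_of_one_le_right (by positivity) hR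
    linarith
  linarith

/-- Outside the ball R^α is below |k+d|^α, so replacing |k| by max(|k|,R) costs only a constant. -/
theorem gevreyWeight_high_le (h0 : 0 < α) (h1 : α < 1) {R : ℝ} (hR : 1 ≤ R) (k : Fin n → ℤ)
    {d : Fin n → ℤ} (hd : d ∈ cube n 2) (hk : k + d ∉ latticeBall n R) :
    gevreyWeight n α 0 R k
      ≤ ENNReal.ofReal (neighbourConst n α) * gevreyWeight n α 0 0 (k + d) := by
  unfold gevreyWeight neighbourConst
  rw [← ENNReal.ofReal_mul (Real.exp_pos _).le, ← Real.exp_add]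
  refine ENNReal.ofReal_le_ofReal (Real.exp_le_exp.2 ?_)
  rw [max_eq_left (norm_nonneg (latticePoint (k + d)))]
  rw [mem_latticeBall, not_le] at hk
  have e1 := rpow_norm_latticePoint_le h0 h1 k hd
  have e2 : R ^ α ≤ ‖latticePoint (k + d)‖ ^ α := Real.rpow_le_rpow (by linarith) hk.le h0.le
  have e3 : 0 ≤ (2 * √(n : ℝ)) ^ α := by positivity
  have e4 : max ‖latticePoint k‖ R ^ α ≤ ‖latticePoint (k + d)‖ ^ α + (2 * √n) ^ α := by
    rcases max_choice ‖latticePoint k‖ R with h | h <;> rw [h]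
    · exact e1
    · linarith
  have e5 : 0 ≤ 2 * √(n : ℝ) := by positivity
  linarith

/-- The constant in the synthesis estimates. -/
def synthConst (ρ : Space n → ℝ) (α : ℝ) : ℝ≥0∞ :=
  (cube n 2).card * (ENNReal.ofReal (neighbourConst n α) * kerOne ρ)

theorem synthConst_ne_top (hρ : IsWindow ρ) (α : ℝ) : synthConst ρ α ≠ ∞ :=
  ENNReal.mul_ne_top (ENNReal.natCast_ne_top _)
    (ENNReal.mul_ne_top ENNReal.ofReal_ne_top (kerOne_ne_top hρ))

theorem wNorm_low_le (hρ : IsWindow ρ) (hp1 : p ≠ ∞) (hq : 1 ≤ q) (h0 : 0 < α) (h1 : α < 1)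
    {R : ℝ} (hR : 1 ≤ R) {u : Space n → ℂ} (hu : MemLp u p volume) :
    wNorm ρ p q (gevreyWeight n α (1 / R) 0) (fun x => ∑ l ∈ latticeBall n R, bx ρ l u x)
      ≤ synthConst ρ α * wNorm ρ p q (gevreyWeight n α 0 0) u := by
  classical
  exact wNorm_synthesis_le hρ hp1 hq hu (↑(latticeBall n R))
    (fun k x => by simpa using bx_sum_bx hρ hp1 hu (latticeBall n R) k x)
    fun k d hd hk => gevreyWeight_low_le h0 h1 hR k hd (Finset.mem_coe.1 hk)

theorem wNorm_high_le (hρ : IsWindow ρ) (hp1 : p ≠ ∞) (hq : 1 ≤ q) (h0 : 0 < α) (h1 : α < 1)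
    {R : ℝ} (hR : 1 ≤ R) {u : Space n → ℂ} (hu : MemLp u p volume) :
    wNorm ρ p q (gevreyWeight n α 0 R) (fun x => u x - ∑ l ∈ latticeBall n R, bx ρ l u x)
      ≤ synthConst ρ α * wNorm ρ p q (gevreyWeight n α 0 0) u := by
  classical
  exact wNorm_synthesis_le hρ hp1 hq hu (↑(latticeBall n R))ᶜ
    (fun k x => by simpa using bx_sub_sum_bx hρ hp1 hu (latticeBall n R) k x)
    fun k d hd hk => gevreyWeight_high_le h0 h1 hR k hd (by simpa using hk)

omit hp in
/-- Interpolation between the trivial bound at low frequencies and a bound with an exponential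
weight at high frequencies. -/
theorem wNorm_le_of_bxNorm_le (hq : 1 ≤ q) (h0 : 0 < α) {R K : ℝ} (hR : 0 < R) {f : Space n → ℂ}
    {C : ℝ≥0∞} (hf : ∀ k, bxNorm ρ p f k ≤ C) :
    wNorm ρ p q (gevreyWeight n α 0 0) f
      ≤ ENNReal.ofReal (Real.exp (2 * K ^ α)) * C * ∑' k, gevreyGain n α k
        + ENNReal.ofReal (Real.exp (-(K / R))) * wNorm ρ p q (gevreyWeight n α (1 / R) 0) f := by
  have hg := gain_le_half h0.le
  have key : ∀ k, gevreyWeight n α 0 0 k * bxNorm ρ p f k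
      ≤ ENNReal.ofReal (Real.exp (2 * K ^ α)) * C * gevreyGain n α k
        + ENNReal.ofReal (Real.exp (-(K / R)))
          * (gevreyWeight n α (1 / R) 0 k * bxNorm ρ p f k) := fun k => by
    rcases le_total ‖latticePoint k‖ K with hk | hk
    · refine le_trans ?_ le_self_add
      -- Since g ≤ 1/2, |k|^α + g|k|^α ≤ 2K^α; the spare room leaves the factor e^{-g|k|^α}, which
      -- makes the bound summable in k.
      calc gevreyWeight n α 0 0 k * bxNorm ρ p f k
          ≤ (ENNReal.ofReal (Real.exp (2 * K ^ α)) * gevreyGain n α k) * C := by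
            refine mul_le_mul' ?_ (hf k)
            unfold gevreyWeight gevreyGain
            rw [← ENNReal.ofReal_mul (Real.exp_pos _).le, ← Real.exp_add]
            refine ENNReal.ofReal_le_ofReal (Real.exp_le_exp.2 ?_)
            rw [max_eq_left (norm_nonneg _)]
            have e1 := Real.rpow_le_rpow (norm_nonneg _) hk h0.le
            have e2 : 0 ≤ ‖latticePoint k‖ ^ α := by positivity
            nlinarith [mul_le_mul_of_nonneg_right hg e2]
        _ = _ := by ring
    -- Beyond K the additional weight e^{|k|/R} is at least e^{K/R}.
    · refine le_trans ?_ le_add_self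
      rw [← mul_assoc]
      gcongr
      unfold gevreyWeight
      rw [← ENNReal.ofReal_mul (Real.exp_pos _).le, ← Real.exp_add]
      refine ENNReal.ofReal_le_ofReal (Real.exp_le_exp.2 ?_)
      have : K / R ≤ 1 / R * ‖latticePoint k‖ := by
        rw [one_div_mul_eq_div]; gcongr
      linarith
  refine (lq_mono key).trans ((lq_add_le hq _ _).trans ?_)
  rw [lq_const_mul hq, lq_const_mul hq]
  gcongr
  · exact lq_le_tsum hq _
  · exact le_rfl

end

end GevreyModulation

end

noncomputable section

namespace GevreyModulation

section

variable {n : ℕ} {ρ : Space n → ℝ} {p q : ℝ≥0∞} [hp : Fact (1 ≤ p)] {α : ℝ}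

/-! ### Exponentials of the high- and low-frequency parts -/

theorem smallFactor_zero (h0 : 0 < α) : smallFactor α 0 = 1 := by
  simp [smallFactor, Real.zero_rpow h0.ne']

theorem isAlgebraWeight_gevreyWeight_zero (h0 : 0 < α) (h1 : α < 1) {ε : ℝ} (hε : 0 ≤ ε)
    (hε1 : ε ≤ 1) : IsAlgebraWeight (gevreyGain n α) (gevreyWeight n α ε 0)
      (ENNReal.ofReal (weightConst n α)) 1 := by
  simpa [smallFactor_zero h0] using isAlgebraWeight_gevreyWeight (n := n) h0 h1 hε hε1 le_rfl

/-- The constant in the exponential bound for the low frequencies. -/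
def lowConst (ρ : Space n → ℝ) (p : ℝ≥0∞) (α : ℝ) : ℝ≥0∞ :=
  mulConst ρ p (gevreyGain n α) * ENNReal.ofReal (weightConst n α) * synthConst ρ α

/-- The constant that determines where to split the frequencies. -/
def splitConst (ρ : Space n → ℝ) (p : ℝ≥0∞) (α : ℝ) : ℝ≥0∞ :=
  lowConst ρ p α + nikConst ρ p * (∑' k, gevreyGain n α k) * synthConst ρ α

omit hp in
theorem lowConst_ne_top (hρ : IsWindow ρ) (h0 : 0 < α) (h1 : α < 1) : lowConst ρ p α ≠ ∞ :=
  ENNReal.mul_ne_top (ENNReal.mul_ne_top (mulConst_ne_top hρ (tsum_gevreyGain_ne_top h0 h1))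
    ENNReal.ofReal_ne_top) (synthConst_ne_top hρ α)

omit hp in
theorem splitConst_ne_top (hρ : IsWindow ρ) (h0 : 0 < α) (h1 : α < 1) : splitConst ρ p α ≠ ∞ :=
  ENNReal.add_ne_top.2 ⟨lowConst_ne_top hρ h0 h1, ENNReal.mul_ne_top (ENNReal.mul_ne_top
    (nikConst_ne_top hρ) (tsum_gevreyGain_ne_top h0 h1)) (synthConst_ne_top hρ α)⟩

/-- The exponential of the high-frequency part. -/
theorem wNorm_exp_high_le (hρ : IsWindow ρ) (hp1 : p ≠ ∞) (hq : 1 ≤ q) (h0 : 0 < α) (h1 : α < 1)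
    {R : ℝ} (hR : 1 ≤ R) {N : ℝ≥0∞} (hN : N ≠ ∞)
    (hsmall : splitConst ρ p α * N * ENNReal.ofReal (smallFactor α R) ≤ 1)
    {w : Space n → ℂ} (hw : MemLp w p volume)
    (hwN : wNorm ρ p q (gevreyWeight n α 0 R) w ≤ synthConst ρ α * N) :
    (MemLp (fun x => Complex.exp (Complex.I * w x) - 1) p volume ∧
      wNorm ρ p q (gevreyWeight n α 0 0) (fun x => Complex.exp (Complex.I * w x) - 1)
        ≤ ENNReal.ofReal (Real.exp 1) * synthConst ρ α * N) ∧ ∀ᵐ x, ‖w x‖ ≤ 1 := by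
  have hγ := tsum_gevreyGain_ne_top (n := n) h0 h1
  have hR0 : 0 ≤ R := zero_le_one.trans hR
  have hW := isAlgebraWeight_gevreyWeight (n := n) h0 h1 le_rfl zero_le_one hR0
  have hwf : wNorm ρ p q (gevreyWeight n α 0 R) w ≠ ∞ :=
    ne_top_of_le_ne_top (ENNReal.mul_ne_top (synthConst_ne_top hρ α) hN) hwN
  have hs0 : 0 ≤ smallFactor α R := (Real.exp_pos _).le
  refine ⟨?_, ?_⟩
  · have h := wNorm_exp_sub_one_le hρ hp1 hq hW hγ ENNReal.ofReal_ne_top ENNReal.ofReal_ne_top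
      hw hwf
    refine ⟨h.1, (wNorm_mono (fun k => ?_) _).trans (h.2.trans ?_)⟩
    · refine ENNReal.ofReal_le_ofReal (Real.exp_le_exp.2 ?_)
      gcongr
    -- The small factor in the algebra constant brings the exponent of the series bound below one;
    -- this uses the first summand of `splitConst`.
    have hle : mulConst ρ p (gevreyGain n α)
        * ENNReal.ofReal (weightConst n α * smallFactor α R)
        * wNorm ρ p q (gevreyWeight n α 0 R) w ≤ 1 := by
      refine le_trans ?_ hsmall
      rw [ENNReal.ofReal_mul' hs0]
      calc _ ≤ mulConst ρ p (gevreyGain n α) * (ENNReal.ofReal (weightConst n α)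
            * ENNReal.ofReal (smallFactor α R)) * (synthConst ρ α * N) := by gcongr
        _ = lowConst ρ p α * N * ENNReal.ofReal (smallFactor α R) := by rw [lowConst]; ring
        _ ≤ _ := by gcongr; exact le_self_add
    have hle' := ENNReal.toReal_mono ENNReal.one_ne_top hle
    rw [ENNReal.toReal_one] at hle'
    calc _ ≤ (synthConst ρ α * N) * ENNReal.ofReal (Real.exp 1) := by gcongr
      _ = _ := by ring
  -- The embedding constant of the truncated weight is the small factor too; the second summand of
  -- `splitConst` is chosen so that the supremum of |w| is at most one.
  · have hsum := tsum_bxNorm_le (ρ := ρ) (p := p) hq hW w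
    have hfin : ∑' k, bxNorm ρ p w k ≠ ∞ := ne_top_of_le_ne_top
      (ENNReal.mul_ne_top (ENNReal.mul_ne_top ENNReal.ofReal_ne_top hγ) hwf) hsum
    filter_upwards [ae_enorm_le_tsum_bxNorm hρ hp1 hw hfin] with x hx
    have : ‖w x‖ₑ ≤ 1 := by
      refine hx.trans (le_trans ?_ hsmall)
      calc nikConst ρ p * ∑' k, bxNorm ρ p w k
          ≤ nikConst ρ p * (ENNReal.ofReal (smallFactor α R) * (∑' k, gevreyGain n α k)
            * (synthConst ρ α * N)) := by
            gcongr
            exact hsum.trans (by gcongr)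
        _ = nikConst ρ p * (∑' k, gevreyGain n α k) * synthConst ρ α * N
            * ENNReal.ofReal (smallFactor α R) := by ring
        _ ≤ _ := by gcongr; exact le_add_self
    have h2 := ENNReal.toReal_mono ENNReal.one_ne_top this
    simpa using h2

/-- The constant in the estimate of the exponential of the low-frequency part. -/
def lowExpConst (ρ : Space n → ℝ) (α : ℝ) : ℝ≥0∞ :=
  (kerOne ρ * (5 * ((∑' k, gevreyGain n α k) * synthConst ρ α))) * (∑' k, gevreyGain n α k)
    + synthConst ρ α

theorem lowExpConst_ne_top (hρ : IsWindow ρ) (h0 : 0 < α) (h1 : α < 1) :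
    lowExpConst ρ α ≠ ∞ := by
  have hγ := tsum_gevreyGain_ne_top (n := n) h0 h1
  exact ENNReal.add_ne_top.2 ⟨ENNReal.mul_ne_top (ENNReal.mul_ne_top (kerOne_ne_top hρ)
    (ENNReal.mul_ne_top (by simp) (ENNReal.mul_ne_top hγ (synthConst_ne_top hρ α)))) hγ,
    synthConst_ne_top hρ α⟩

/-- The exponential of the low-frequency part. -/
theorem wNorm_exp_low_le (hρ : IsWindow ρ) (hp1 : p ≠ ∞) (hq : 1 ≤ q) (h0 : 0 < α) (h1 : α < 1)
    {R K : ℝ} (hR : 1 ≤ R) {N : ℝ≥0∞} (hN : N ≠ ∞) (hK : (lowConst ρ p α * N).toReal * R ≤ K)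
    {v : Space n → ℂ} (hv : MemLp v p volume)
    (hvN : wNorm ρ p q (gevreyWeight n α (1 / R) 0) v ≤ synthConst ρ α * N)
    (him : ∀ᵐ x, |(v x).im| ≤ 1) :
    MemLp (fun x => Complex.exp (Complex.I * v x) - 1) p volume ∧
      wNorm ρ p q (gevreyWeight n α 0 0) (fun x => Complex.exp (Complex.I * v x) - 1)
        ≤ ENNReal.ofReal (Real.exp (2 * K ^ α)) * lowExpConst ρ α * N := by
  have hγ := tsum_gevreyGain_ne_top (n := n) h0 h1
  have hR0 : 0 < R := zero_lt_one.trans_le hR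
  have hW := isAlgebraWeight_gevreyWeight_zero (n := n) h0 h1 (ε := 1 / R) (by positivity)
    (by rw [div_le_one hR0]; exact hR)
  have hvf : wNorm ρ p q (gevreyWeight n α (1 / R) 0) v ≠ ∞ :=
    ne_top_of_le_ne_top (ENNReal.mul_ne_top (synthConst_ne_top hρ α) hN) hvN
  have h := wNorm_exp_sub_one_le hρ hp1 hq hW hγ ENNReal.ofReal_ne_top ENNReal.one_ne_top hv hvf
  refine ⟨h.1, ?_⟩
  set A : Space n → ℂ := fun x => Complex.exp (Complex.I * v x) - 1
  have hK0 : 0 ≤ K := le_trans (by positivity) hK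
  have hsum : ∑' k, bxNorm ρ p v k ≤ (∑' k, gevreyGain n α k) * (synthConst ρ α * N) := by
    refine (tsum_bxNorm_le (ρ := ρ) (p := p) hq hW v).trans ?_
    rw [one_mul]
    gcongr
  have hsumf : ∑' k, bxNorm ρ p v k ≠ ∞ := ne_top_of_le_ne_top
    (ENNReal.mul_ne_top hγ (ENNReal.mul_ne_top (synthConst_ne_top hρ α) hN)) hsum
  have hA : eLpNorm A p volume ≤ 5 * ((∑' k, gevreyGain n α k) * (synthConst ρ α * N)) := by
    have h5 := eLpNorm_le_mul_eLpNorm_of_ae_le_mul (f := A) (g := v) (c := 5) (μ := volume)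
      (by filter_upwards [him] with x hx using norm_exp_I_mul_sub_one_le hx) p
    refine h5.trans ?_
    rw [ENNReal.ofReal_ofNat]
    gcongr
    exact (eLpNorm_le_tsum_bxNorm hρ hp1 hv hsumf).trans hsum
  have hAk : ∀ k, bxNorm ρ p A k ≤
      kerOne ρ * (5 * ((∑' k, gevreyGain n α k) * (synthConst ρ α * N))) := fun k =>
    (bxNorm_le hρ hp1 h.1.1 k).trans (by gcongr)
  -- The series bound for A costs the exponential of `lowConst` times N, and `hK` says that K/R is
  -- at least this exponent, so the exponentials cancel.
  have hexp : ENNReal.ofReal (Real.exp (-(K / R))) * wNorm ρ p q (gevreyWeight n α (1 / R) 0) A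
      ≤ synthConst ρ α * N := by
    have hle : mulConst ρ p (gevreyGain n α) * ENNReal.ofReal (weightConst n α)
        * wNorm ρ p q (gevreyWeight n α (1 / R) 0) v ≤ lowConst ρ p α * N := by
      rw [lowConst, mul_assoc (mulConst ρ p _ * _)]
      gcongr
    have hle' := ENNReal.toReal_mono (ENNReal.mul_ne_top (lowConst_ne_top hρ h0 h1) hN) hle
    have hle2 : (lowConst ρ p α * N).toReal ≤ K / R := by rwa [le_div_iff₀ hR0]
    calc _ ≤ ENNReal.ofReal (Real.exp (-(K / R)))
          * (synthConst ρ α * N * ENNReal.ofReal (Real.exp (K / R))) := by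
          gcongr
          refine h.2.trans ?_
          gcongr
          exact hle'.trans hle2
      _ = synthConst ρ α * N * (ENNReal.ofReal (Real.exp (-(K / R)))
          * ENNReal.ofReal (Real.exp (K / R))) := by ring
      _ = synthConst ρ α * N := by
          rw [← ENNReal.ofReal_mul (Real.exp_pos _).le, ← Real.exp_add]
          simp
  have hone : 1 ≤ ENNReal.ofReal (Real.exp (2 * K ^ α)) :=
    ENNReal.one_le_ofReal.2 (Real.one_le_exp (by positivity))
  refine (wNorm_le_of_bxNorm_le hq h0 hR0 (K := K) hAk).trans ?_
  calc _ ≤ ENNReal.ofReal (Real.exp (2 * K ^ α))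
        * (kerOne ρ * (5 * ((∑' k, gevreyGain n α k) * (synthConst ρ α * N))))
        * (∑' k, gevreyGain n α k) + 1 * (synthConst ρ α * N) := by
        rw [one_mul]; gcongr
    _ ≤ ENNReal.ofReal (Real.exp (2 * K ^ α))
        * (kerOne ρ * (5 * ((∑' k, gevreyGain n α k) * (synthConst ρ α * N))))
        * (∑' k, gevreyGain n α k)
        + ENNReal.ofReal (Real.exp (2 * K ^ α)) * (synthConst ρ α * N) := by gcongr
    _ = _ := by rw [lowExpConst]; ring

/-- The constant in the estimate of `e^{iu} - 1`. -/
def totalConst (ρ : Space n → ℝ) (p : ℝ≥0∞) (α : ℝ) : ℝ≥0∞ :=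
  mulConst ρ p (gevreyGain n α) * ENNReal.ofReal (weightConst n α) * lowExpConst ρ α
      * (ENNReal.ofReal (Real.exp 1) * synthConst ρ α)
    + lowExpConst ρ α + ENNReal.ofReal (Real.exp 1) * synthConst ρ α

omit hp in
theorem totalConst_ne_top (hρ : IsWindow ρ) (h0 : 0 < α) (h1 : α < 1) :
    totalConst ρ p α ≠ ∞ := by
  have hγ := tsum_gevreyGain_ne_top (n := n) h0 h1
  have hl := lowExpConst_ne_top hρ h0 h1
  have he := ENNReal.mul_ne_top (ENNReal.ofReal_ne_top (r := Real.exp 1)) (synthConst_ne_top hρ α)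
  exact ENNReal.add_ne_top.2 ⟨ENNReal.add_ne_top.2 ⟨ENNReal.mul_ne_top (ENNReal.mul_ne_top
    (ENNReal.mul_ne_top (mulConst_ne_top hρ hγ) ENNReal.ofReal_ne_top) hl) he, hl⟩, he⟩

/-- Combines both parts through e^{iv}e^{iw} - 1 = AB + A + B. Only A carries the large factor
e^{2K^α}. -/
theorem wNorm_exp_sub_one_le_of_real (hρ : IsWindow ρ) (hp1 : p ≠ ∞) (hq : 1 ≤ q) (h0 : 0 < α)
    (h1 : α < 1) {u : Space n → ℂ} (hu : MemLp u p volume) (hreal : ∀ x, (u x).im = 0)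
    {N : ℝ≥0∞} (hN : N ≠ ∞) (huN : wNorm ρ p q (gevreyWeight n α 0 0) u = N) {R K : ℝ}
    (hR : 1 ≤ R) (hsmall : splitConst ρ p α * N * ENNReal.ofReal (smallFactor α R) ≤ 1)
    (hK : (lowConst ρ p α * N).toReal * R ≤ K) :
    MemLp (fun x => Complex.exp (Complex.I * u x) - 1) p volume ∧
      wNorm ρ p q (gevreyWeight n α 0 0) (fun x => Complex.exp (Complex.I * u x) - 1)
        ≤ totalConst ρ p α * ENNReal.ofReal (Real.exp (2 * K ^ α)) * max N 1 * N := by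
  have hγ := tsum_gevreyGain_ne_top (n := n) h0 h1
  set v : Space n → ℂ := fun x => ∑ l ∈ latticeBall n R, bx ρ l u x with hv
  set w : Space n → ℂ := fun x => u x - v x with hw
  have hvm : MemLp v p volume := memLp_finsetSum _ fun l _ => memLp_bx hρ l hu hp1
  have hwm : MemLp w p volume := hu.sub hvm
  have hK0 : 0 ≤ K := le_trans (by positivity) hK
  obtain ⟨⟨hBm, hB⟩, hw1⟩ := wNorm_exp_high_le hρ hp1 hq h0 h1 hR hN hsmall hwm
    (by rw [← huN]; exact wNorm_high_le hρ hp1 hq h0 h1 hR hu)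
  -- The window is not assumed even, so v need not be real-valued; but u is, and hence Im v = -Im w.
  have him : ∀ᵐ x, |(v x).im| ≤ 1 := by
    filter_upwards [hw1] with x hx
    have : (v x).im = -(w x).im := by simp [hw, hreal]
    rw [this, abs_neg]
    exact (Complex.abs_im_le_norm _).trans hx
  obtain ⟨hAm, hA⟩ := wNorm_exp_low_le hρ hp1 hq h0 h1 hR hN hK hvm
    (by rw [← huN]; exact wNorm_low_le hρ hp1 hq h0 h1 hR hu) him
  set A : Space n → ℂ := fun x => Complex.exp (Complex.I * v x) - 1
  set B : Space n → ℂ := fun x => Complex.exp (Complex.I * w x) - 1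
  have hF : (fun x => Complex.exp (Complex.I * u x) - 1)
      = fun x => (A x * B x + A x) + B x := by
    ext x
    have : Complex.I * u x = Complex.I * v x + Complex.I * w x := by simp only [hw]; ring
    simp only [A, B]
    rw [this, Complex.exp_add]
    ring
  have hW := isAlgebraWeight_gevreyWeight_zero (n := n) h0 h1 le_rfl zero_le_one
  have hfin : ∀ g : Space n → ℂ, wNorm ρ p q (gevreyWeight n α 0 0) g ≠ ∞ →
      ∑' k, bxNorm ρ p g k ≠ ∞ := fun g hg =>
    ne_top_of_le_ne_top (ENNReal.mul_ne_top (ENNReal.mul_ne_top ENNReal.one_ne_top hγ) hg)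
      (tsum_bxNorm_le hq hW g)
  have hAs := hfin A (ne_top_of_le_ne_top (ENNReal.mul_ne_top (ENNReal.mul_ne_top
    ENNReal.ofReal_ne_top (lowExpConst_ne_top hρ h0 h1)) hN) hA)
  have hBs := hfin B (ne_top_of_le_ne_top (ENNReal.mul_ne_top (ENNReal.mul_ne_top
    ENNReal.ofReal_ne_top (synthConst_ne_top hρ α)) hN) hB)
  have hABm := (mul_expansion hρ hp1 hAm hBm hAs hBs).1
  have hAB := wNorm_mul_le hρ hp1 hq hW hAm hBm hAs hBs
  rw [hF]
  refine ⟨(hABm.add hAm).add hBm, ?_⟩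
  set E := ENNReal.ofReal (Real.exp (2 * K ^ α))
  have hE : 1 ≤ E := ENNReal.one_le_ofReal.2 (Real.one_le_exp (by positivity))
  -- Only AB is quadratic in N, whence the factor max(N,1). Factors at least one are inserted into
  -- the linear terms so that the three constants add up to `totalConst`.
  calc _ ≤ wNorm ρ p q (gevreyWeight n α 0 0) (fun x => A x * B x)
        + wNorm ρ p q (gevreyWeight n α 0 0) A + wNorm ρ p q (gevreyWeight n α 0 0) B :=
        (wNorm_add_le hρ hq _ (hABm.add hAm) hBm).trans
          (add_le_add (wNorm_add_le hρ hq _ hABm hAm) le_rfl)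
    _ ≤ mulConst ρ p (gevreyGain n α) * ENNReal.ofReal (weightConst n α)
          * (E * lowExpConst ρ α * N) * (ENNReal.ofReal (Real.exp 1) * synthConst ρ α * max N 1)
        + E * lowExpConst ρ α * N * max N 1
        + E * (ENNReal.ofReal (Real.exp 1) * synthConst ρ α * N) * max N 1 := by
        gcongr
        · refine hAB.trans ?_
          gcongr
          refine hB.trans ?_
          gcongr
          exact le_max_left _ _
        · exact hA.trans (le_mul_of_one_le_right' (le_max_right _ _))
        · exact (hB.trans (le_mul_of_one_le_left' hE)).trans
            (le_mul_of_one_le_right' (le_max_right _ _))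
    _ = _ := by rw [totalConst]; ring

end

/-! ### Choice of the splitting radius and growth of the exponent -/

theorem exists_split_radius {α C M : ℝ} (h0 : 0 < α) (h1 : α < 1) (hC : Real.exp 1 ≤ C)
    (hM : 1 ≤ M) : ∃ R : ℝ, 1 ≤ R ∧ C * M * smallFactor α R = 1 ∧
      R ^ α = (Real.log C + Real.log M) / gain α := by
  have hg := gain_pos h1
  have hg2 := gain_le_half h0.le
  have hC0 : 0 < C := (Real.exp_pos 1).trans_le hC
  have hM0 : 0 < M := zero_lt_one.trans_le hM
  have hl : 1 ≤ Real.log C := (Real.le_log_iff_exp_le hC0).2 hC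
  have hl' : 0 ≤ Real.log M := Real.log_nonneg hM
  -- R solves C M e^{-gR^α} = 1. The assumption C ≥ e together with g ≤ 1/2 forces R ≥ 1.
  set T := (Real.log C + Real.log M) / gain α with hT
  have hT1 : 1 ≤ T := by rw [hT, le_div_iff₀ hg]; linarith
  have hR : (T ^ α⁻¹) ^ α = T := Real.rpow_inv_rpow (by linarith) h0.ne'
  refine ⟨T ^ α⁻¹, Real.one_le_rpow hT1 (by positivity), ?_, hR⟩
  rw [smallFactor, hR, hT, mul_div_cancel₀ _ hg.ne', Real.exp_neg, Real.exp_add,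
    Real.exp_log hC0, Real.exp_log hM0]
  field_simp

/-- Absorbs a surplus factor M = e^{log M} and the part of the exponent without logarithm. For M ≥ e
the logarithm is at least one; for M ≤ e it may vanish, and the constant 3 bounds M^α. -/
theorem log_add_mul_rpow_le {α P M : ℝ} (h0 : 0 < α) (h1 : α < 1) (hP : 0 ≤ P) (hM : 1 ≤ M) :
    Real.log M + P * (M ^ α * (1 + Real.log M))
      ≤ 3 * P + (1 + 2 * P) * (M ^ α * Real.log M) := by
  have hl : 0 ≤ Real.log M := Real.log_nonneg hM
  have hMa : 1 ≤ M ^ α := Real.one_le_rpow hM h0.le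
  have e1 : Real.log M ≤ M ^ α * Real.log M := le_mul_of_one_le_left hl hMa
  have e2 : M ^ α ≤ 3 + M ^ α * Real.log M := by
    rcases le_total M (Real.exp 1) with h | h
    · have : M ^ α ≤ 3 := by
        calc M ^ α ≤ M ^ (1 : ℝ) := Real.rpow_le_rpow_of_exponent_le hM h1.le
          _ = M := Real.rpow_one M
          _ ≤ 3 := h.trans Real.exp_one_lt_three.le
      nlinarith
    · have : 1 ≤ Real.log M := (Real.le_log_iff_exp_le (by linarith)).2 h
      nlinarith
  nlinarith [mul_le_mul_of_nonneg_left e2 hP]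

end GevreyModulation

end

/-! ### The estimate in terms of the norm of u -/

noncomputable section

namespace GevreyModulation

theorem exists_wNorm_exp_sub_one_bound {n : ℕ} {ρ : Space n → ℝ} (hρ : IsWindow ρ)
    {p q : ℝ≥0∞} [Fact (1 ≤ p)] (hp1 : p ≠ ∞) (hq : 1 ≤ q) {α : ℝ} (h0 : 0 < α) (h1 : α < 1) :
    ∃ T P : ℝ, 0 ≤ T ∧ 0 ≤ P ∧ ∀ u : Space n → ℂ, MemLp u p volume → (∀ x, (u x).im = 0) →
      ∀ N : ℝ≥0∞, N ≠ ∞ → wNorm ρ p q (gevreyWeight n α 0 0) u = N →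
      MemLp (fun x => Complex.exp (Complex.I * u x) - 1) p volume ∧
      wNorm ρ p q (gevreyWeight n α 0 0) (fun x => Complex.exp (Complex.I * u x) - 1) ≠ ∞ ∧
      (wNorm ρ p q (gevreyWeight n α 0 0) (fun x => Complex.exp (Complex.I * u x) - 1)).toReal
        ≤ T * Real.exp (P * (max N.toReal 1 ^ α * (1 + Real.log (max N.toReal 1))))
          * max N.toReal 1 * N.toReal := by
  have hg := gain_pos h1
  -- Adding e guarantees C ≥ e, as the choice of the radius requires.
  set C := (splitConst ρ p α).toReal + Real.exp 1 with hC
  have hCe : Real.exp 1 ≤ C := le_add_of_nonneg_left ENNReal.toReal_nonneg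
  have hC1 : 0 ≤ Real.log C := Real.log_nonneg ((Real.one_le_exp zero_le_one).trans hCe)
  set L := (lowConst ρ p α).toReal
  have hL : 0 ≤ L := ENNReal.toReal_nonneg
  -- P comes from 2K^α = 2L^α N^α R^α with g R^α = log C + log M ≤ (1 + log C)(1 + log M). Working
  -- with M = max(N,1) lets the same radius formula serve small norms.
  refine ⟨(totalConst ρ p α).toReal, 2 * L ^ α * (1 + Real.log C) / gain α,
    ENNReal.toReal_nonneg, by positivity, fun u hu hreal N hN huN => ?_⟩
  set M := max N.toReal 1
  have hM1 : 1 ≤ M := le_max_right _ _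
  have hNM : N.toReal ≤ M := le_max_left _ _
  have hlM : 0 ≤ Real.log M := Real.log_nonneg hM1
  obtain ⟨R, hR, hsf, hRα⟩ := exists_split_radius h0 h1 hCe hM1
  have hsf0 : 0 ≤ smallFactor α R := (Real.exp_pos _).le
  have hsplit := splitConst_ne_top (p := p) hρ h0 h1
  have hsmall : splitConst ρ p α * N * ENNReal.ofReal (smallFactor α R) ≤ 1 := by
    rw [← ENNReal.ofReal_toReal hsplit, ← ENNReal.ofReal_toReal hN,
      ← ENNReal.ofReal_mul ENNReal.toReal_nonneg, ← ENNReal.ofReal_mul (by positivity),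
      ← ENNReal.ofReal_one, ← hsf]
    refine ENNReal.ofReal_le_ofReal ?_
    gcongr
    exact le_add_of_nonneg_right (Real.exp_pos 1).le
  set K := (lowConst ρ p α * N).toReal * R with hK
  obtain ⟨hm, hle⟩ := wNorm_exp_sub_one_le_of_real hρ hp1 hq h0 h1 hu hreal hN huN hR hsmall
    (le_refl K)
  have hfin : totalConst ρ p α * ENNReal.ofReal (Real.exp (2 * K ^ α)) * max N 1 * N ≠ ∞ :=
    ENNReal.mul_ne_top (ENNReal.mul_ne_top (ENNReal.mul_ne_top (totalConst_ne_top hρ h0 h1)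
      ENNReal.ofReal_ne_top) (by simp [hN])) hN
  refine ⟨hm, ne_top_of_le_ne_top hfin hle, (ENNReal.toReal_mono hfin hle).trans ?_⟩
  have hKα : 2 * K ^ α ≤ 2 * L ^ α * (1 + Real.log C) / gain α * (M ^ α * (1 + Real.log M)) := by
    have e1 : K ^ α = L ^ α * N.toReal ^ α * ((Real.log C + Real.log M) / gain α) := by
      rw [hK, ENNReal.toReal_mul, Real.mul_rpow (by positivity) (by linarith),
        Real.mul_rpow hL ENNReal.toReal_nonneg, hRα]
    have e2 : N.toReal ^ α ≤ M ^ α := Real.rpow_le_rpow ENNReal.toReal_nonneg hNM h0.le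
    have e3 : Real.log C + Real.log M ≤ (1 + Real.log C) * (1 + Real.log M) := by nlinarith
    calc 2 * K ^ α = 2 * (L ^ α * N.toReal ^ α * ((Real.log C + Real.log M) / gain α)) := by
          rw [e1]
      _ ≤ 2 * (L ^ α * M ^ α * (((1 + Real.log C) * (1 + Real.log M)) / gain α)) := by gcongr
      _ = _ := by ring
  rw [ENNReal.toReal_mul, ENNReal.toReal_mul, ENNReal.toReal_mul,
    ENNReal.toReal_ofReal (Real.exp_pos _).le, ENNReal.toReal_max hN ENNReal.one_ne_top,
    ENNReal.toReal_one]
  gcongr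

end GevreyModulation

end

theorem mainTheorem4 (n : ℕ) (hn : 1 ≤ n) (s : ℝ) (hs : 1 < s)
    (p q : ℝ≥0∞) [Fact (1 ≤ p)] (hp₁ : 1 < p) (hp : p < ∞) (hq : 1 ≤ q)
    (ρ : EuclideanSpace ℝ (Fin n) → ℝ) (hρ : GevreyModulation.IsWindow ρ) :
    ∃ b c : ℝ, 0 < b ∧ 0 < c ∧
      ∀ u : EuclideanSpace ℝ (Fin n) → ℝ,
        GevreyModulation.MemGM s p q ρ (fun x => (u x : ℂ)) →
          GevreyModulation.MemGM s p q ρ (fun x => Complex.exp (Complex.I * (u x : ℂ)) - 1) ∧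
          (1 < GevreyModulation.gmNorm s p q ρ (fun x => (u x : ℂ)) →
            GevreyModulation.gmNorm s p q ρ (fun x => Complex.exp (Complex.I * (u x : ℂ)) - 1) ≤
              c * GevreyModulation.gmNorm s p q ρ (fun x => (u x : ℂ)) *
                Real.exp (b * GevreyModulation.gmNorm s p q ρ (fun x => (u x : ℂ)) ^ (1 / s) *
                  Real.log (GevreyModulation.gmNorm s p q ρ (fun x => (u x : ℂ))))) ∧
          (GevreyModulation.gmNorm s p q ρ (fun x => (u x : ℂ)) ≤ 1 →
            GevreyModulation.gmNorm s p q ρ (fun x => Complex.exp (Complex.I * (u x : ℂ)) - 1) ≤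
              c * GevreyModulation.gmNorm s p q ρ (fun x => (u x : ℂ))) := by
  have hα0 : 0 < 1 / s := by positivity
  have hα1 : 1 / s < 1 := by rw [div_lt_one (by positivity)]; exact hs
  obtain ⟨T, P, hT, hP, H⟩ :=
    GevreyModulation.exists_wNorm_exp_sub_one_bound hρ hp.ne hq hα0 hα1
  -- These are the constants of `log_add_mul_rpow_le`; the summand 1 keeps c positive if T = 0.
  refine ⟨1 + 2 * P, T * Real.exp (3 * P) + 1, by positivity, by positivity, fun u hu => ?_⟩
  have hN := hu.2
  rw [GevreyModulation.gmENormFun_eq hρ hp.ne s hu.1] at hN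
  obtain ⟨hm, hfin, hle⟩ := H _ hu.1 (fun x => Complex.ofReal_im _) _ hN.ne rfl
  have hgu := GevreyModulation.gmENormFun_eq (q := q) hρ hp.ne s hu.1
  have hgF := GevreyModulation.gmENormFun_eq (q := q) hρ hp.ne s hm
  rw [← hgu, ← hgF] at hle
  rw [← hgF] at hfin
  change GevreyModulation.gmNorm s p q ρ (fun x => Complex.exp (Complex.I * (u x : ℂ)) - 1) ≤ _
    at hle
  refine ⟨⟨hm, hfin.lt_top⟩, ?_⟩
  change _ ≤ T * Real.exp (P * (max (GevreyModulation.gmNorm s p q ρ fun x => (u x : ℂ)) 1 ^ (1 / s)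
    * (1 + Real.log (max (GevreyModulation.gmNorm s p q ρ fun x => (u x : ℂ)) 1))))
    * max (GevreyModulation.gmNorm s p q ρ fun x => (u x : ℂ)) 1
    * GevreyModulation.gmNorm s p q ρ (fun x => (u x : ℂ)) at hle
  have hM0 : 0 ≤ GevreyModulation.gmNorm s p q ρ fun x => (u x : ℂ) := ENNReal.toReal_nonneg
  generalize (GevreyModulation.gmNorm s p q ρ fun x => (u x : ℂ)) = M at hle hM0 ⊢
  refine ⟨fun hM => hle.trans ?_, fun hM => hle.trans ?_⟩
  · rw [max_eq_left hM.le]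
    have h := GevreyModulation.log_add_mul_rpow_le hα0 hα1 hP hM.le
    calc T * Real.exp (P * (M ^ (1 / s) * (1 + Real.log M))) * M * M
        -- One of the two factors M moves into the exponent as log M, leaving the linear factor of
        -- the claim.
        = T * M * Real.exp (Real.log M + P * (M ^ (1 / s) * (1 + Real.log M))) := by
          rw [Real.exp_add, Real.exp_log (zero_lt_one.trans hM)]; ring
      _ ≤ T * M * Real.exp (3 * P + (1 + 2 * P) * (M ^ (1 / s) * Real.log M)) := by gcongr
      _ = T * Real.exp (3 * P) * M * Real.exp ((1 + 2 * P) * M ^ (1 / s) * Real.log M) := by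
          rw [Real.exp_add, mul_assoc (1 + 2 * P)]; ring
      _ ≤ _ := by
          gcongr
          linarith
  · rw [max_eq_right hM, Real.log_one, Real.one_rpow]
    have : Real.exp (P * (1 * (1 + 0))) ≤ Real.exp (3 * P) := Real.exp_le_exp.2 (by linarith)
    calc T * Real.exp (P * (1 * (1 + 0))) * 1 * M ≤ T * Real.exp (3 * P) * 1 * M := by gcongr
      _ ≤ _ := by nlinarith
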